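/- Let $\lambda_1,\lambda_2,\beta>0$ and let $\Pi^1,\Pi^2,\Pi^{12}$ be mutually independent Poisson flows on $[0,\infty)$ with intensities $\lambda_1,\lambda_2,\beta$ (for each of them, the gaps between successive points, starting at $0$, are independent and exponentially distributed with parameter equal to the intensity). Two processors have local times $x_1(t),x_2(t)\in\mathbf{Z}$, $t\ge 0$, which start at an arbitrary deterministic state $(x_1(0),x_2(0))\in\mathbf{Z}^2$ and change only as follows: at each point of $\Pi^k$ the local time $x_k$ increases by $1$ ($k=1,2$); at each point of $\Pi^{12}$ processor $1$ sends a message to processor $2$, and if $x_2>x_1$ at this moment, then $x_2$ is rolled back to the value $x_1$ (otherwise nothing changes). Take the right-continuous version of the process. Let $0=\tau_0<\tau_1<\tau_2<\cdots$ be the successive points of $\Pi^1\cup\Pi^2\cup\Pi^{12}$ and let $Y(n)=x_2(\tau_n)-x_1(\tau_n)$. Then $(Y(n))_{n\ge 0}$ is a Markov chain on $\mathbf{Z}$ started at $x_2(0)-x_1(0)$ whose transition probabilities are, with $Z=\lambda_1+\lambda_2+\beta$: from $i$ it moves to $i+1$ with probability $\lambda_2/Z$, to $i-1$ with probability $\lambda_1/Z$,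 and with the remaining probability $\beta/Z$ it moves to $0$ if $i\ge 0$ and stays at $i$ if $i<0$ (probabilities of coinciding targets add up). Moreover: (1) If $\lambda_1<\lambda_2$, then the Markov chain $Y(n)$ is ergodic, that is, there is a probability distribution $\pi$ on $\mathbf{Z}$ with $\pi_j>0$ for all $j$ such that the $n$-step transition probabilities satisfy $p^{(n)}_{ij}\to\pi_j$ as $n\to\infty$ for all $i,j$; and both asymptotic speeds equal $\lambda_1$: $x_1(t)/t\to\lambda_1$ and $x_2(t)/t\to\lambda_1$ in probability as $t\to\infty$. (2) If $\lambda_1>\lambda_2$, then the Markov chain $Y(n)$ is transient, that is, from every state the probability of ever returning to it is less than $1$; moreover $x_2(t)-x_1(t)\to-\infty$ almost surely as $t\to\infty$, and $x_1(t)/t\to\lambda_1$ and $x_2(t)/t\to\lambda_2$ in probability as $t\to\infty$. -/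

import Mathlib

open MeasureTheory ProbabilityTheory Filter Topology
open scoped ENNReal

namespace TwoProc

noncomputable section

/-! ### Countable Markov chains, described by their transition probabilities -/

/-- The `n`-step transition probabilities of the transition matrix `p`. -/
def nStep {S : Type*} (p : S → S → ℝ≥0∞) : ℕ → S → S → ℝ≥0∞
  | 0 => fun i j => by classical exact if i = j then 1 else 0
  | n + 1 => fun i j => ∑' k, p i k * nStep p n k j

/-- `firstPassage p n i j` is the probability that the chain started at `i` enters `j`
(at a positive time) for the first time at time `n + 1`. -/
def firstPassage {S : Type*} (p : S → S → ℝ≥0∞) : ℕ → S → S → ℝ≥0∞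
  | 0 => fun i j => p i j
  | n + 1 => fun i j =>
      ∑' k, (by classical exact if k = j then 0 else p i k * firstPassage p n k j)

/-- `(Y n)` is a time-homogeneous Markov chain under `P`, with transition matrix `p` and started
at the state `i`. -/
def IsMarkovChain {Ω S : Type*} [MeasurableSpace Ω] (P : Measure Ω) (Y : ℕ → Ω → S)
    (p : S → S → ℝ≥0∞) (i : S) : Prop :=
  ∀ (n : ℕ) (y : ℕ → S),
    P {ω | ∀ k ≤ n, Y k ω = y k} =
      (by classical exact if y 0 = i then 1 else 0) * ∏ k ∈ Finset.range n, p (y k) (y (k + 1))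

/-- Ergodicity: from every initial state the chain converges in law to one and the same
probability distribution, which charges every state. (As all the limits are positive, the chain
is in particular irreducible, aperiodic and positive recurrent.) -/
def IsErgodic {S : Type*} (p : S → S → ℝ≥0∞) : Prop :=
  ∃ π : S → ℝ≥0∞, (∀ j, 0 < π j) ∧ ∑' j, π j = 1 ∧
    ∀ i j, Tendsto (fun n => nStep p n i j) atTop (𝓝 (π j))

/-- Transience: from every state, the probability of ever returning to it is less than one. -/
def IsTransient {S : Type*} (p : S → S → ℝ≥0∞) : Prop :=
  ∀ i, ∑' n, firstPassage p n i i < 1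

/-! ### The model with two processors -/

/-- A Poissonian flow `0 = σ 0 < σ 1 < ⋯` of intensity `r`: the gaps `σ (n + 1) - σ n` are
independent, exponentially distributed with parameter `r` (that is, with mean `r⁻¹`). -/
structure IsPoissonFlow {Ω : Type*} [MeasurableSpace Ω] (P : Measure Ω) (σ : ℕ → Ω → ℝ)
    (r : ℝ) : Prop where
  measurable : ∀ n, Measurable (σ n)
  zero : ∀ ω, σ 0 ω = 0
  indep : iIndepFun (fun n ω => σ (n + 1) ω - σ n ω) P
  law : ∀ n, P.map (fun ω => σ (n + 1) ω - σ n ω) = expMeasure r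

/-- The three flows: updates of the local time of processor 1, updates of the local time of
processor 2, and messages sent by processor 1 to processor 2. -/
inductive Source where
  | update1
  | update2
  | message

/-- The intensities of the three flows. -/
def rate (l1 l2 b : ℝ) : Source → ℝ
  | .update1 => l1
  | .update2 => l2
  | .message => b

/-- The effect of an event on the pair `(x₁, x₂)` of local times: an update adds one, a message
rolls `x₂` back to `x₁` when `x₂ > x₁` and has no effect otherwise. -/
def act : Source → ℤ × ℤ → ℤ × ℤ
  | .update1, x => (x.1 + 1, x.2)
  | .update2, x => (x.1, x.2 + 1)
  | .message, x => (x.1, if x.1 < x.2 then x.1 else x.2)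

/-- `t` is one of the time instants `s c 1, s c 2, …` of the flow `c`. -/
def IsInstant (s : Source → ℕ → ℝ) (c : Source) (t : ℝ) : Prop :=
  ∃ n : ℕ, s c (n + 1) = t

/-- The successive event times `0 = τ 0 < τ 1 < τ 2 < ⋯` of the union of the three flows. -/
def eventTime (s : Source → ℕ → ℝ) : ℕ → ℝ
  | 0 => 0
  | n + 1 => sInf {t : ℝ | eventTime s n < t ∧ ∃ c, IsInstant s c t}

open Classical in
/-- Perform the event of type `c` if time `t` is an instant of the flow `c`. -/
def actAt (s : Source → ℕ → ℝ) (t : ℝ) (c : Source) (x : ℤ × ℤ) : ℤ × ℤ :=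
  if IsInstant s c t then act c x else x

/-- The local times immediately after the first `n` events, from the initial state `x₀`.
(Almost surely the three flows have no common instant, so that exactly one of the three
actions is performed at each event time and their order does not matter.) -/
def stateAfter (s : Source → ℕ → ℝ) (x₀ : ℤ × ℤ) : ℕ → ℤ × ℤ
  | 0 => x₀
  | n + 1 =>
      actAt s (eventTime s (n + 1)) .message
        (actAt s (eventTime s (n + 1)) .update2
          (actAt s (eventTime s (n + 1)) .update1 (stateAfter s x₀ n)))

/-- The state `(x₁(t), x₂(t))` at time `t` (right-continuous version): the number of events in
`(0, t]` is counted, and the state is the one after these events. -/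
def stateAt (s : Source → ℕ → ℝ) (x₀ : ℤ × ℤ) (t : ℝ) : ℤ × ℤ :=
  stateAfter s x₀ (Set.ncard {n : ℕ | 0 < n ∧ eventTime s n ≤ t})

section

variable {Ω : Type*}

/-- The continuous-time process `(x₁(t), x₂(t))` driven by the flows `σ`. -/
def X (σ : Source → ℕ → Ω → ℝ) (x₀ : ℤ × ℤ) (t : ℝ) (ω : Ω) : ℤ × ℤ :=
  stateAt (fun c n => σ c n ω) x₀ t

/-- The local time `x₁(t)` of processor 1. -/
def x1 (σ : Source → ℕ → Ω → ℝ) (x₀ : ℤ × ℤ) (t : ℝ) (ω : Ω) : ℤ := (X σ x₀ t ω).1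

/-- The local time `x₂(t)` of processor 2. -/
def x2 (σ : Source → ℕ → Ω → ℝ) (x₀ : ℤ × ℤ) (t : ℝ) (ω : Ω) : ℤ := (X σ x₀ t ω).2

/-- The relative chain `Y(n) = x₂(τ n) - x₁(τ n)`, embedded at the event times. -/
def Y (σ : Source → ℕ → Ω → ℝ) (x₀ : ℤ × ℤ) (n : ℕ) (ω : Ω) : ℤ :=
  x2 σ x₀ (eventTime (fun c k => σ c k ω) n) ω - x1 σ x₀ (eventTime (fun c k => σ c k ω) n) ω

/-- The process `x` has the asymptotic speed `v`: `x(t) / t → v` in probability. -/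
def HasSpeed [MeasurableSpace Ω] (P : Measure Ω) (x : ℝ → Ω → ℤ) (v : ℝ) : Prop :=
  TendstoInMeasure P (fun t ω => (x t ω : ℝ) / t) atTop (fun _ => v)

end

/-- The transition probabilities of the relative chain, with `Z = l1 + l2 + b`: from `i` it jumps
to `i + 1` with weight `l2 / Z`, to `i - 1` with weight `l1 / Z`, and with weight `b / Z` it
jumps to `0` if `i ≥ 0` and stays at `i` if `i < 0` (weights of coinciding targets add up). -/
def transProb (l1 l2 b : ℝ) (i j : ℤ) : ℝ≥0∞ :=
  ENNReal.ofReal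
    ((if j = i + 1 then l2 / (l1 + l2 + b) else 0) +
      (if j = i - 1 then l1 / (l1 + l2 + b) else 0) +
      (if j = (if 0 ≤ i then 0 else i) then b / (l1 + l2 + b) else 0))

end

end TwoProc

namespace TwoProc

/-! ### The transition matrix of the relative chain -/

/-! The three flows form a race of exponential clocks: the flow that rings first is `c` with
probability `rate c / Z`, and by lack of memory the gaps seen from that instant again have the
original law, independently of the winner (`race`). Pathwise, the events after the first one are the
events of these advanced flows started from `act c x` (`Regular.stateAfter_succ_advance`). Induction
on the number of events then gives the Markov property of the lag (`gapsLaw_lag_chainState`).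

Ergodicity comes from an explicit stationary law, geometric on each half-line (`exists_stationary`),
and a coupling: two chains driven by the same events merge at the first message that finds both at
nonnegative states, which gives a geometric bound (`exists_contraction`). Transience comes from a
supersolution of the hitting equations (`isTransient_transProb`).

The speeds do not use the chain. They are deterministic consequences, path by path, of the law of
large numbers for the three counting functions: `x₁` only counts the points of the first flow, and
the lag is squeezed between expressions in the counting functions (`linearGrowth_lag_of_lt`,
`linearGrowth_lag_of_gt`). The lag is `o(t)` when `l1 < l2` and `(l2 - l1) t + o(t)` when `l2 < l1`.
-/

instance : DecidableEq Source := fun a b => by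
  cases a <;> cases b <;> first | exact isTrue rfl | exact isFalse (fun h => nomatch h)

instance : Fintype Source :=
  ⟨{.update1, .update2, .message}, fun c => by cases c <;> simp⟩

lemma sum_source {M : Type*} [AddCommMonoid M] (f : Source → M) :
    ∑ c, f c = f .update1 + f .update2 + f .message := by
  have : (Finset.univ : Finset Source) = {.update1, .update2, .message} := rfl
  rw [this, Finset.sum_insert (by simp), Finset.sum_insert (by simp), Finset.sum_singleton,
    add_assoc]

/-- The effect of an event on the difference `x₂ - x₁` of the local times. -/
def step : Source → ℤ → ℤ
  | .update1, i => i - 1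
  | .update2, i => i + 1
  | .message, i => min i 0

/-- The probability that an event is of a given type. -/
noncomputable def typeProb (l1 l2 b : ℝ) (c : Source) : ℝ := rate l1 l2 b c / (l1 + l2 + b)

section
variable {l1 l2 b : ℝ}

lemma rate_pos (hl1 : 0 < l1) (hl2 : 0 < l2) (hb : 0 < b) (c : Source) : 0 < rate l1 l2 b c := by
  cases c <;> simpa [rate]

lemma typeProb_pos (hl1 : 0 < l1) (hl2 : 0 < l2) (hb : 0 < b) (c : Source) :
    0 < typeProb l1 l2 b c := div_pos (rate_pos hl1 hl2 hb c) (by positivity)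

lemma sum_typeProb (hl1 : 0 < l1) (hl2 : 0 < l2) (hb : 0 < b) :
    typeProb l1 l2 b .update1 + typeProb l1 l2 b .update2 + typeProb l1 l2 b .message = 1 := by
  simp only [typeProb, rate]
  have : l1 + l2 + b ≠ 0 := by positivity
  field_simp

/-- The chain is a random iteration of the maps `step c`, with `c` drawn from `typeProb`. This form
supports both the coupling and the identification with the embedded process. -/
lemma transProb_eq_sum (hl1 : 0 < l1) (hl2 : 0 < l2) (hb : 0 < b) (i j : ℤ) :
    transProb l1 l2 b i j =
      ∑ c, if j = step c i then ENNReal.ofReal (typeProb l1 l2 b c) else 0 := by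
  have hp : ∀ c, 0 ≤ typeProb l1 l2 b c := fun c => (typeProb_pos hl1 hl2 hb c).le
  have h0 : min i 0 = if 0 ≤ i then 0 else i := by split_ifs <;> omega
  have key : ∀ (c : Source), (if j = step c i then ENNReal.ofReal (typeProb l1 l2 b c) else 0) =
      ENNReal.ofReal (if j = step c i then typeProb l1 l2 b c else 0) := by
    intro c; split_ifs <;> simp
  have hn : ∀ c, 0 ≤ if j = step c i then typeProb l1 l2 b c else 0 := by
    intro c; split_ifs
    exacts [hp c, le_rfl]
  simp_rw [key]
  rw [← ENNReal.ofReal_sum_of_nonneg (fun c _ => hn c), sum_source, transProb]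
  simp only [step, h0, typeProb, rate]
  congr 1; congr 1; exact add_comm _ _

lemma tsum_transProb_mul (hl1 : 0 < l1) (hl2 : 0 < l2) (hb : 0 < b) (g : ℤ → ℝ≥0∞) (i : ℤ) :
    ∑' k, transProb l1 l2 b i k * g k =
      ∑ c, ENNReal.ofReal (typeProb l1 l2 b c) * g (step c i) := by
  simp_rw [transProb_eq_sum hl1 hl2 hb, Finset.sum_mul, ite_mul, zero_mul]
  rw [Summable.tsum_finsetSum (fun _ _ => ENNReal.summable)]
  refine Finset.sum_congr rfl fun c _ => ?_
  exact tsum_ite_eq (step c i) (fun k => ENNReal.ofReal (typeProb l1 l2 b c) * g k)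

/-! ### Transience -/

/-- A supersolution of the equations for the hitting probabilities of `j` bounds them. -/
lemma sum_firstPassage_le {S : Type*} (p : S → S → ℝ≥0∞) (j : S) (g : S → ℝ≥0∞) (hgj : g j = 1)
    (hg : ∀ k, k ≠ j → ∑' m, p k m * g m ≤ g k) (n : ℕ) (k : S) :
    ∑ m ∈ Finset.range n, firstPassage p m k j ≤ ∑' m, p k m * g m := by
  classical
  induction n generalizing k with
  | zero => simp
  | succ n ih =>
    rw [Finset.sum_range_succ']
    simp only [firstPassage]
    rw [← Summable.tsum_finsetSum (fun _ _ => ENNReal.summable)]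
    -- The direct jump to `j` becomes the `m = j` term of the sum over the first step, so that the
    -- two sides compare term by term.
    have hpk : p k j = ∑' m, if m = j then p k m else 0 := (tsum_ite_eq j (fun m => p k m)).symm
    rw [hpk, ← ENNReal.tsum_add]
    refine ENNReal.tsum_le_tsum fun m => ?_
    by_cases hm : m = j
    · simp [hm, hgj]
    · simp only [hm, if_false, add_zero]
      rw [← Finset.mul_sum]
      gcongr
      exact (ih m).trans (hg m hm)

/-- The supersolution is `G k = ρ ^ (j - k)⁺` with `ρ = l2 / l1`, the probability that the walk
without messages climbs from `k` to `j`. Below `j` it is harmonic for that walk, and messages only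
decrease it because it is monotone and they move the chain down; above `j` it equals 1. From `j`, a
step down has value `ρ < 1`, so the return probability is less than 1. -/
lemma isTransient_transProb (hl1 : 0 < l1) (hl2 : 0 < l2) (hb : 0 < b) (h : l2 < l1) :
    IsTransient (transProb l1 l2 b) := by
  intro j
  set p : Source → ℝ := typeProb l1 l2 b with hp
  have hpos : ∀ c, 0 < p c := typeProb_pos hl1 hl2 hb
  have hsum : p .update1 + p .update2 + p .message = 1 := sum_typeProb hl1 hl2 hb
  set ρ : ℝ := l2 / l1 with hρ
  have hρ0 : 0 < ρ := by positivity
  have hρ1 : ρ < 1 := by rw [hρ, div_lt_one hl1]; exact h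
  have hp12 : p .update1 * ρ = p .update2 := by
    simp only [hp, typeProb, rate, hρ]; field_simp
  clear_value ρ
  set G : ℤ → ℝ := fun k => ρ ^ (j - k).toNat with hG
  have hG0 : ∀ k, 0 ≤ G k := fun k => by positivity
  have hG1 : ∀ k, G k ≤ 1 := fun k => pow_le_one₀ hρ0.le hρ1.le
  have hGmono : Monotone G := by
    intro k k' hk
    exact pow_le_pow_of_le_one hρ0.le hρ1.le (by omega)
  have hsumG : ∀ k, ∑' m, transProb l1 l2 b k m * ENNReal.ofReal (G m) =
      ENNReal.ofReal (p .update1 * G (k - 1) + p .update2 * G (k + 1) +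
        p .message * G (min k 0)) := by
    intro k
    rw [tsum_transProb_mul hl1 hl2 hb, sum_source]
    simp only [← hp, step]
    rw [← ENNReal.ofReal_mul (hpos _).le, ← ENNReal.ofReal_mul (hpos _).le,
      ← ENNReal.ofReal_mul (hpos _).le, ← ENNReal.ofReal_add, ← ENNReal.ofReal_add]
    all_goals
      have := fun c k => mul_nonneg (hpos c).le (hG0 k)
      first | exact this _ _ | exact add_nonneg (this _ _) (this _ _)
  have hsuper : ∀ k, k ≠ j →
      ∑' m, transProb l1 l2 b k m * ENNReal.ofReal (G m) ≤ ENNReal.ofReal (G k) := by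
    intro k hk
    rw [hsumG]
    refine ENNReal.ofReal_le_ofReal ?_
    have hm : G (min k 0) ≤ G k := hGmono (min_le_left _ _)
    have hm' := mul_le_mul_of_nonneg_left hm (hpos .message).le
    rcases lt_or_gt_of_ne hk with hlt | hgt
    · obtain ⟨n, hn⟩ : ∃ n : ℕ, j - k = n + 1 := ⟨(j - k - 1).toNat, by omega⟩
      have e1 : G k = ρ ^ (n + 1) := by simp only [hG]; congr 1; omega
      have e2 : G (k - 1) = ρ ^ (n + 2) := by simp only [hG]; congr 1; omega
      have e3 : G (k + 1) = ρ ^ n := by simp only [hG]; congr 1; omega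
      have : p .update1 * G (k - 1) + p .update2 * G (k + 1) =
          (p .update1 + p .update2) * G k := by
        rw [e1, e2, e3, ← hp12]; ring
      have hs := congrArg (· * G k) hsum
      simp only [one_mul] at hs
      linarith
    · have e1 : G k = 1 := by
        simp only [hG]; rw [show (j - k).toNat = 0 by omega, pow_zero]
      have h1 := mul_le_mul_of_nonneg_left (hG1 (k - 1)) (hpos .update1).le
      have h2 := mul_le_mul_of_nonneg_left (hG1 (k + 1)) (hpos .update2).le
      rw [e1] at hm' ⊢
      linarith
  have hbound : ∑' n, firstPassage (transProb l1 l2 b) n j j ≤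
      ∑' m, transProb l1 l2 b j m * ENNReal.ofReal (G m) :=
    ENNReal.tsum_le_of_sum_range_le fun n =>
      sum_firstPassage_le _ j (fun k => ENNReal.ofReal (G k)) (by simp [hG]) hsuper n j
  refine hbound.trans_lt ?_
  rw [hsumG, ← ENNReal.ofReal_one]
  refine (ENNReal.ofReal_lt_ofReal_iff one_pos).2 ?_
  have e : G (j - 1) = ρ := by
    simp only [hG]; rw [show (j - (j - 1)).toNat = 1 by omega, pow_one]
  have h2 := mul_le_mul_of_nonneg_left (hG1 (j + 1)) (hpos .update2).le
  have h3 := mul_le_mul_of_nonneg_left (hG1 (min j 0)) (hpos .message).le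
  have h1 := mul_lt_mul_of_pos_left hρ1 (hpos .update1)
  rw [e]
  linarith

/-! ### Ergodicity -/

/-- A law `π` on `ℤ`, geometric on each half-line. -/
noncomputable def twoSided (C r s : ℝ) (i : ℤ) : ℝ :=
  if 0 ≤ i then C * s ^ i.toNat else C * r ^ (-i).toNat

lemma hasSum_twoSided_nonneg {C r s : ℝ} (hs0 : 0 ≤ s) (hs : s < 1) :
    HasSum (fun i : ℤ => if 0 ≤ i then twoSided C r s i else 0) (C / (1 - s)) := by
  have h1 : HasSum (fun n : ℕ => (fun i : ℤ => if 0 ≤ i then twoSided C r s i else 0) n)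
      (C / (1 - s)) := by
    have := (hasSum_geometric_of_lt_one hs0 hs).mul_left C
    simpa [twoSided, div_eq_mul_inv] using this
  have h2 : HasSum (fun n : ℕ => (fun i : ℤ => if 0 ≤ i then twoSided C r s i else 0)
      (-(n + 1 : ℤ))) 0 := by
    convert (hasSum_zero : HasSum (fun _ : ℕ => (0 : ℝ)) 0) using 2 with n
    exact if_neg (by omega)
  rw [← add_zero (C / (1 - s))]
  exact HasSum.of_nat_of_neg_add_one h1 h2

lemma hasSum_twoSided {C r s : ℝ} (hr0 : 0 ≤ r) (hr : r < 1) (hs0 : 0 ≤ s) (hs : s < 1) :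
    HasSum (twoSided C r s) (C / (1 - s) + C * r / (1 - r)) := by
  refine HasSum.of_nat_of_neg_add_one ?_ ?_
  · have := (hasSum_geometric_of_lt_one hs0 hs).mul_left C
    simpa [twoSided, div_eq_mul_inv] using this
  · have := (hasSum_geometric_of_lt_one hr0 hr).mul_left (C * r)
    rw [div_eq_mul_inv]
    refine this.congr_fun fun n => ?_
    simp only [twoSided]
    rw [if_neg (by omega), show (-(-(n + 1 : ℤ))).toNat = n + 1 by omega, pow_succ]
    ring

/-- Below 0 messages are self-loops and drop out of the balance equation, whose solution decaying at
`-∞` has ratio `r = l1 / l2`. Above 0 messages only remove mass, and the ratio `s` solves `l1 s² - Z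
s + l2 = 0`. At 0 the message inflow is the mass of the whole nonnegative half-line, and the balance
follows from the equations for `r` and `s`. -/
lemma exists_stationary (hl1 : 0 < l1) (hl2 : 0 < l2) (hb : 0 < b) (h : l1 < l2) :
    ∃ π : ℤ → ℝ, (∀ i, 0 < π i) ∧ HasSum π 1 ∧
      ∀ j, HasSum (fun i => π i * (transProb l1 l2 b i j).toReal) (π j) := by
  obtain ⟨s, hs, hroot⟩ : ∃ s ∈ Set.Ioo (0 : ℝ) 1, l1 * s ^ 2 - (l1 + l2 + b) * s + l2 = 0 := by
    have hc : ContinuousOn (fun s : ℝ => l1 * s ^ 2 - (l1 + l2 + b) * s + l2) (Set.Icc 0 1) := by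
      fun_prop
    -- The quadratic equals `l2 > 0` at 0 and `-b < 0` at 1.
    have := intermediate_value_Ioo' zero_le_one hc
    refine this ?_
    constructor <;> simp <;> linarith
  set r := l1 / l2 with hr
  have hr0 : 0 < r := by positivity
  have hr1 : r < 1 := by rw [hr, div_lt_one hl2]; exact h
  have hrl : l2 * r = l1 := by rw [hr]; field_simp
  set C : ℝ := (1 / (1 - s) + r / (1 - r))⁻¹ with hC
  have hs1 : 0 < 1 - s := by linarith [hs.2]
  have hr2 : 0 < 1 - r := by linarith
  have hden : 0 < 1 / (1 - s) + r / (1 - r) := by positivity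
  have hC0 : 0 < C := inv_pos.2 hden
  have hs0 : 0 < s := hs.1
  clear_value C r
  refine ⟨twoSided C r s, ?_, ?_, ?_⟩
  · intro i; unfold twoSided; split_ifs <;> positivity
  · have := hasSum_twoSided (C := C) hr0.le hr1 hs.1.le hs.2
    convert this using 1
    rw [hC]; field_simp
  · intro j
    set Z := l1 + l2 + b with hZ
    have hZ0 : 0 < Z := by positivity
    have hP : ∀ i, (transProb l1 l2 b i j).toReal =
        (if i = j + 1 then l1 / Z else 0) + (if i = j - 1 then l2 / Z else 0) +
          (if j = min i 0 then b / Z else 0) := by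
      intro i
      have h0 : min i 0 = if 0 ≤ i then 0 else i := by split_ifs <;> omega
      rw [transProb, ENNReal.toReal_ofReal, h0, ← hZ]
      · have e1 : (j = i + 1) ↔ i = j - 1 := by omega
        have e2 : (j = i - 1) ↔ i = j + 1 := by omega
        simp only [e1, e2]; congr 1; exact add_comm _ _
      · rw [← hZ]
        have : ∀ (q : Prop) [Decidable q] (x : ℝ), 0 ≤ x → 0 ≤ if q then x else 0 := by
          intro q _ x hx; split_ifs <;> simp [hx]
        exact add_nonneg (add_nonneg (this _ _ (by positivity)) (this _ _ (by positivity)))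
          (this _ _ (by positivity))
    set π := twoSided C r s with hπ
    have s1 := hasSum_ite_eq (j + 1) (π (j + 1) * (l1 / Z))
    have s2 := hasSum_ite_eq (j - 1) (π (j - 1) * (l2 / Z))
    have hπneg : ∀ n : ℕ, π (-(n : ℤ)) = C * r ^ n := by
      intro n
      simp only [hπ, twoSided]
      split_ifs with hn
      · have : n = 0 := by omega
        simp [this]
      · congr 2; omega
    have hπpos : ∀ n : ℕ, π (n : ℤ) = C * s ^ n := by
      intro n
      simp [hπ, twoSided]
    have hfun : ∀ i, π i * (transProb l1 l2 b i j).toReal =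
        (if i = j + 1 then π (j + 1) * (l1 / Z) else 0) +
          (if i = j - 1 then π (j - 1) * (l2 / Z) else 0) +
          (if j = min i 0 then π i * (b / Z) else 0) := by
      intro i
      rw [hP, mul_add, mul_add]
      congr 1
      · congr 1
        · split_ifs with hi
          · rw [hi]
          · simp
        · split_ifs with hi
          · rw [hi]
          · simp
      · split_ifs <;> simp
    simp_rw [hfun]
    rcases lt_trichotomy j 0 with hj | hj | hj
    · have s3 : HasSum (fun i => if j = min i 0 then π i * (b / Z) else 0) (π j * (b / Z)) := by
        convert hasSum_ite_eq j (π j * (b / Z)) using 2 with i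
        by_cases hi : i = j
        · rw [if_pos (by omega), if_pos hi, hi]
        · rw [if_neg (by omega), if_neg hi]
      convert (s1.add s2).add s3 using 1
      obtain ⟨n, hn⟩ : ∃ n : ℕ, j = -((n + 1 : ℕ) : ℤ) := ⟨(-j - 1).toNat, by omega⟩
      rw [show j + 1 = -(n : ℤ) by omega, show j - 1 = -((n + 2 : ℕ) : ℤ) by omega, hn,
        hπneg, hπneg, hπneg, hZ, ← hrl]
      have : l2 * r + l2 + b ≠ 0 := by positivity
      field_simp
      ring
    · have s3 : HasSum (fun i => if j = min i 0 then π i * (b / Z) else 0)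
          (C / (1 - s) * (b / Z)) := by
        refine ((hasSum_twoSided_nonneg (C := C) (r := r) hs.1.le hs.2).mul_right
          (b / Z)).congr_fun fun i => ?_
        rw [ite_mul, zero_mul]
        congr 1
        rw [hj, eq_iff_iff]; omega
      convert (s1.add s2).add s3 using 1
      rw [hj, show (0 : ℤ) + 1 = ((1 : ℕ) : ℤ) by simp, show (0 : ℤ) - 1 = -((1 : ℕ) : ℤ) by simp,
        show (0 : ℤ) = ((0 : ℕ) : ℤ) by simp, hπneg, hπpos, hπpos]
      field_simp
      linear_combination hroot - (1 - s) * hrl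
    · have s3 : HasSum (fun i => if j = min i 0 then π i * (b / Z) else 0) 0 := by
        convert (hasSum_zero : HasSum (fun _ : ℤ => (0 : ℝ)) 0) using 2 with i
        rw [if_neg (by omega)]
      convert (s1.add s2).add s3 using 1
      obtain ⟨n, hn⟩ : ∃ n : ℕ, j = ((n + 1 : ℕ) : ℤ) := ⟨(j - 1).toNat, by omega⟩
      rw [show j + 1 = ((n + 2 : ℕ) : ℤ) by omega, show j - 1 = (n : ℤ) by omega, hn,
        hπpos, hπpos, hπpos]
      field_simp
      linear_combination -(C * s ^ n) * hroot

lemma nStep_le_one (hl1 : 0 < l1) (hl2 : 0 < l2) (hb : 0 < b) (n : ℕ) (i j : ℤ) :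
    nStep (transProb l1 l2 b) n i j ≤ 1 := by
  induction n generalizing i with
  | zero => simp only [nStep]; split_ifs <;> simp
  | succ n ih =>
    simp only [nStep]
    calc ∑' k, transProb l1 l2 b i k * nStep (transProb l1 l2 b) n k j
        ≤ ∑' k, transProb l1 l2 b i k * 1 := by gcongr; exact ih _
      _ = 1 := by
        rw [tsum_transProb_mul hl1 hl2 hb]
        simp only [mul_one]
        rw [← ENNReal.ofReal_sum_of_nonneg (fun c _ => (typeProb_pos hl1 hl2 hb c).le), sum_source,
          sum_typeProb hl1 hl2 hb, ENNReal.ofReal_one]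

lemma nStep_succ_toReal (hl1 : 0 < l1) (hl2 : 0 < l2) (hb : 0 < b) (n : ℕ) (i j : ℤ) :
    (nStep (transProb l1 l2 b) (n + 1) i j).toReal =
      typeProb l1 l2 b .update1 * (nStep (transProb l1 l2 b) n (i - 1) j).toReal +
      typeProb l1 l2 b .update2 * (nStep (transProb l1 l2 b) n (i + 1) j).toReal +
      typeProb l1 l2 b .message * (nStep (transProb l1 l2 b) n (min i 0) j).toReal := by
  have hfin : ∀ n i j, nStep (transProb l1 l2 b) n i j ≠ ∞ := fun n i j =>
    ((nStep_le_one hl1 hl2 hb n i j).trans_lt ENNReal.one_lt_top).ne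
  simp only [nStep]
  rw [tsum_transProb_mul hl1 hl2 hb (fun k => nStep (transProb l1 l2 b) n k j)]
  rw [ENNReal.toReal_sum (fun c _ => ENNReal.mul_ne_top ENNReal.ofReal_ne_top (hfin _ _ _)),
    sum_source]
  simp only [ENNReal.toReal_mul, ENNReal.toReal_ofReal (typeProb_pos hl1 hl2 hb _).le, step]

/-- Two chains driven by the same events merge at a geometric rate. -/
lemma exists_contraction (hl1 : 0 < l1) (hl2 : 0 < l2) (hb : 0 < b) (h : l1 < l2) :
    ∃ θ a : ℝ, 0 ≤ θ ∧ θ < 1 ∧ ∀ (n : ℕ) (i i' j : ℤ), i ≤ i' →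
      |(nStep (transProb l1 l2 b) n i j).toReal - (nStep (transProb l1 l2 b) n i' j).toReal| ≤
        θ ^ n * a ^ (-i).toNat := by
  set p : Source → ℝ := typeProb l1 l2 b with hp
  have hpos : ∀ c, 0 < p c := typeProb_pos hl1 hl2 hb
  have hsum : p .update1 + p .update2 + p .message = 1 := sum_typeProb hl1 hl2 hb
  have h12 : p .update1 < p .update2 := by
    simp only [hp, typeProb, rate]; gcongr
  have p1 := hpos .update1
  have p2 := hpos .update2
  have p3 := hpos .message
  -- The weight `a ^ i⁻` of the lower chain acts as a Lyapunov function. The bound `a p₁ < p₂` makes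
  -- it contract below 0; the bound `a p₁ < p₁ + p₃` lets the loss of the message term pay for a
  -- step down from 0.
  obtain ⟨a, ha1, ha⟩ : ∃ a, 1 < a ∧
      a < min (p .update2) (p .update1 + p .message) / p .update1 := by
    refine exists_between ?_
    rw [lt_div_iff₀ p1, one_mul]
    exact lt_min h12 (by linarith)
  rw [lt_div_iff₀ p1, lt_min_iff] at ha
  obtain ⟨ha2, ha3⟩ := ha
  have ha0 : 0 < a := by linarith
  set θ := max (p .update1 * a + p .update2 / a + p .message) (p .update1 * a + p .update2) with hθ
  have hθ0 : 0 ≤ θ := le_max_of_le_right (by positivity)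
  refine ⟨θ, a, hθ0, ?_, ?_⟩
  · refine max_lt ?_ (by linarith)
    have : p .update1 * a + p .update2 / a < p .update1 + p .update2 := by
      rw [← sub_pos]
      have : p .update1 + p .update2 - (p .update1 * a + p .update2 / a) =
          (p .update2 - a * p .update1) * (a - 1) / a := by field_simp; ring
      rw [this]
      have := sub_pos.2 ha2
      have := sub_pos.2 ha1
      positivity
    linarith
  · intro n
    induction n with
    | zero =>
      intro i i' j _
      have h1 : ∀ i, 0 ≤ (nStep (transProb l1 l2 b) 0 i j).toReal ∧
          (nStep (transProb l1 l2 b) 0 i j).toReal ≤ 1 := fun i =>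
        ⟨ENNReal.toReal_nonneg, ENNReal.toReal_le_of_le_ofReal zero_le_one
          (by simpa using nStep_le_one hl1 hl2 hb 0 i j)⟩
      have h2 : (1 : ℝ) ≤ a ^ (-i).toNat := one_le_pow₀ ha1.le
      have := h1 i
      have := h1 i'
      rw [pow_zero, one_mul, abs_le]
      constructor <;> linarith
    | succ n ih =>
      intro i i' j hi
      rw [nStep_succ_toReal hl1 hl2 hb, nStep_succ_toReal hl1 hl2 hb]
      have b1 := ih (i - 1) (i' - 1) j (by omega)
      have b2 := ih (i + 1) (i' + 1) j (by omega)
      have b3 := ih (min i 0) (min i' 0) j (by omega)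
      set q := fun i => (nStep (transProb l1 l2 b) n i j).toReal with hq
      have e : p .update1 * q (i - 1) + p .update2 * q (i + 1) + p .message * q (min i 0) -
          (p .update1 * q (i' - 1) + p .update2 * q (i' + 1) + p .message * q (min i' 0)) =
          p .update1 * (q (i - 1) - q (i' - 1)) + p .update2 * (q (i + 1) - q (i' + 1)) +
          p .message * (q (min i 0) - q (min i' 0)) := by ring
      refine (congrArg abs e).trans_le ?_
      refine (abs_add_three _ _ _).trans ?_
      rw [abs_mul, abs_mul, abs_mul, abs_of_pos p1, abs_of_pos p2, abs_of_pos p3]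
      have c1 := mul_le_mul_of_nonneg_left b1 p1.le
      have c2 := mul_le_mul_of_nonneg_left b2 p2.le
      have hθn : 0 ≤ θ ^ n := by positivity
      rcases lt_or_ge i 0 with hneg | hnn
      · have c3 := mul_le_mul_of_nonneg_left b3 p3.le
        obtain ⟨m, hm⟩ : ∃ m : ℕ, -i = m + 1 := ⟨(-i - 1).toNat, by omega⟩
        rw [show (-(i - 1)).toNat = m + 2 by omega] at c1
        rw [show (-(i + 1)).toNat = m by omega] at c2
        rw [show (-(min i 0)).toNat = m + 1 by omega] at c3
        rw [show (-i).toNat = m + 1 by omega]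
        have hle : p .update1 * a + p .update2 / a + p .message ≤ θ := le_max_left _ _
        refine (add_le_add (add_le_add c1 c2) c3).trans ?_
        calc _ = θ ^ n * a ^ (m + 1) * (p .update1 * a + p .update2 / a + p .message) := by
              field_simp; ring
          _ ≤ θ ^ n * a ^ (m + 1) * θ := by gcongr
          _ = _ := by ring
      -- The coupling succeeds here: a message sends both chains to 0.
      · have e0 : q (min i 0) - q (min i' 0) = 0 := by
          rw [min_eq_right hnn, min_eq_right (hnn.trans hi), sub_self]
        rw [e0, abs_zero, mul_zero, add_zero, show (-i).toNat = 0 by omega, pow_zero, mul_one]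
        rw [show (-(i + 1)).toNat = 0 by omega, pow_zero, mul_one] at c2
        have hle : p .update1 * a + p .update2 ≤ θ := le_max_right _ _
        have h3 : a ^ (-(i - 1)).toNat ≤ a := by
          calc a ^ (-(i - 1)).toNat ≤ a ^ 1 := pow_le_pow_right₀ ha1.le (by omega)
            _ = a := pow_one a
        have c1' : p .update1 * |q (i - 1) - q (i' - 1)| ≤ p .update1 * (θ ^ n * a) :=
          c1.trans (by gcongr)
        calc _ ≤ p .update1 * (θ ^ n * a) + p .update2 * θ ^ n := add_le_add c1' c2
          _ = θ ^ n * (p .update1 * a + p .update2) := by ring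
          _ ≤ θ ^ n * θ := by gcongr
          _ = _ := by ring

/-- By stationarity `q n i j - π j` is the `π`-average over `k` of `q n i j - q n k j`. Each term
tends to 0 by the coupling bound, and dominated convergence with dominating function `π` concludes;
the bound need not be uniform in `k`. -/
lemma isErgodic_transProb (hl1 : 0 < l1) (hl2 : 0 < l2) (hb : 0 < b) (h : l1 < l2) :
    IsErgodic (transProb l1 l2 b) := by
  obtain ⟨π, hπ0, hπ1, hstat⟩ := exists_stationary hl1 hl2 hb h
  obtain ⟨θ, a, hθ0, hθ1, hcon⟩ := exists_contraction hl1 hl2 hb h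
  set p := transProb l1 l2 b with hp
  have hfin : ∀ n i j, nStep p n i j ≠ ∞ := fun n i j =>
    ((nStep_le_one hl1 hl2 hb n i j).trans_lt ENNReal.one_lt_top).ne
  have hstep : ∀ j, ∑' i, ENNReal.ofReal (π i) * p i j = ENNReal.ofReal (π j) := by
    intro j
    rw [← (hstat j).tsum_eq, ENNReal.ofReal_tsum_of_nonneg
      (fun i => mul_nonneg (hπ0 i).le ENNReal.toReal_nonneg) (hstat j).summable]
    refine tsum_congr fun i => ?_
    rw [ENNReal.ofReal_mul (hπ0 i).le, ENNReal.ofReal_toReal]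
    exact ENNReal.ofReal_ne_top
  have hinv : ∀ n j, ∑' i, ENNReal.ofReal (π i) * nStep p n i j = ENNReal.ofReal (π j) := by
    intro n j
    induction n with
    | zero => simp [nStep]
    | succ n ih =>
      simp only [nStep]
      simp_rw [← ENNReal.tsum_mul_left]
      rw [ENNReal.tsum_comm]
      simp_rw [← mul_assoc, ENNReal.tsum_mul_right, hstep]
      exact ih
  set q : ℕ → ℤ → ℤ → ℝ := fun n i j => (nStep p n i j).toReal with hq
  have hq0 : ∀ n i j, 0 ≤ q n i j := fun _ _ _ => ENNReal.toReal_nonneg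
  have hq1 : ∀ n i j, q n i j ≤ 1 := fun n i j =>
    ENNReal.toReal_le_of_le_ofReal zero_le_one (by simpa using nStep_le_one hl1 hl2 hb n i j)
  have hsumm : ∀ n j, Summable fun i => π i * q n i j := fun n j =>
    Summable.of_nonneg_of_le (fun i => mul_nonneg (hπ0 i).le (hq0 _ _ _))
      (fun i => mul_le_of_le_one_right (hπ0 i).le (hq1 _ _ _)) hπ1.summable
  have hinv' : ∀ n j, ∑' i, π i * q n i j = π j := by
    intro n j
    have h1 := congrArg ENNReal.toReal (hinv n j)
    rw [ENNReal.tsum_toReal_eq (fun i => ENNReal.mul_ne_top ENNReal.ofReal_ne_top (hfin _ _ _)),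
      ENNReal.toReal_ofReal (hπ0 j).le] at h1
    rw [← h1]
    refine tsum_congr fun i => ?_
    rw [ENNReal.toReal_mul, ENNReal.toReal_ofReal (hπ0 i).le]
  refine ⟨fun j => ENNReal.ofReal (π j), fun j => by simpa using hπ0 j, ?_, fun i j => ?_⟩
  · rw [← ENNReal.ofReal_tsum_of_nonneg (fun i => (hπ0 i).le) hπ1.summable, hπ1.tsum_eq,
      ENNReal.ofReal_one]
  · have hdiff : ∀ k, Tendsto (fun n => π k * (q n i j - q n k j)) atTop (𝓝 0) := by
      intro k
      have hgeo : ∀ m : ℕ, Tendsto (fun n => θ ^ n * a ^ m) atTop (𝓝 0) := fun m => by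
        simpa using (tendsto_pow_atTop_nhds_zero_of_lt_one hθ0 hθ1).mul_const (a ^ m)
      have : Tendsto (fun n => q n i j - q n k j) atTop (𝓝 0) := by
        rcases le_total i k with hik | hik
        · exact squeeze_zero_norm (fun n => hcon n i k j hik) (hgeo _)
        · refine squeeze_zero_norm (fun n => ?_) (hgeo (-k).toNat)
          rw [Real.norm_eq_abs, abs_sub_comm]
          exact hcon n k i j hik
      simpa using this.const_mul (π k)
    have hlim := tendsto_tsum_of_dominated_convergence (bound := π) hπ1.summable hdiff
      (Eventually.of_forall fun n k => by
        rw [norm_mul, Real.norm_of_nonneg (hπ0 k).le]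
        refine mul_le_of_le_one_right (hπ0 k).le ?_
        rw [Real.norm_eq_abs, abs_le]
        constructor <;> linarith [hq0 n i j, hq0 n k j, hq1 n i j, hq1 n k j])
    simp only [tsum_zero] at hlim
    have heq : ∀ n, ∑' k, π k * (q n i j - q n k j) = q n i j - π j := by
      intro n
      simp_rw [mul_sub]
      rw [(hπ1.summable.mul_right _).tsum_sub (hsumm n j), tsum_mul_right, hπ1.tsum_eq, one_mul,
        hinv']
    simp_rw [heq] at hlim
    have hlim' : Tendsto (fun n => q n i j) atTop (𝓝 (π j)) := by
      simpa using hlim.add_const (π j)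
    have := ENNReal.tendsto_ofReal hlim'
    refine this.congr fun n => ?_
    exact ENNReal.ofReal_toReal (hfin n i j)

end

/-! ### The exponential distribution -/

section Exponential
variable {r : ℝ}

lemma expMeasure_eq_withDensity (r : ℝ) :
    expMeasure r = volume.withDensity (exponentialPDF r) := rfl

lemma measurable_exponentialPDF (r : ℝ) : Measurable (exponentialPDF r) :=
  (measurable_exponentialPDFReal r).ennreal_ofReal

instance (r : ℝ) : NullSingletonClass (expMeasure r) := by
  rw [expMeasure_eq_withDensity]; infer_instance

lemma lintegral_expMeasure (r : ℝ) {f : ℝ → ℝ≥0∞} (hf : Measurable f) :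
    ∫⁻ x, f x ∂expMeasure r = ∫⁻ x, exponentialPDF r x * f x := by
  rw [expMeasure_eq_withDensity,
    lintegral_withDensity_eq_lintegral_mul _ (measurable_exponentialPDF r) hf]
  rfl

lemma ae_pos_expMeasure (r : ℝ) : ∀ᵐ x ∂expMeasure r, 0 < x := by
  have h0 : ∀ᵐ x ∂expMeasure r, x ≠ 0 := by
    rw [ae_iff]; simp
  have h1 : ∀ᵐ x ∂expMeasure r, 0 ≤ x := by
    rw [expMeasure_eq_withDensity, ae_withDensity_iff (measurable_exponentialPDF r)]
    refine Eventually.of_forall fun x hx => ?_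
    by_contra hneg
    exact hx (exponentialPDF_of_neg (not_le.1 hneg))
  filter_upwards [h0, h1] with x h0 h1 using lt_of_le_of_ne h1 h0.symm

/-- The exponential distribution has no memory. -/
lemma expMeasure_memoryless {g : ℝ} (hg : 0 ≤ g) {B : Set ℝ}
    (hB : MeasurableSet B) :
    expMeasure r {y | g < y ∧ y - g ∈ B} =
      ENNReal.ofReal (Real.exp (-(r * g))) * expMeasure r B := by
  have hpos : expMeasure r B = expMeasure r (Set.Ioi 0 ∩ B) := by
    refine measure_congr ?_
    filter_upwards [ae_pos_expMeasure r] with x hx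
    apply propext
    exact ⟨fun h => ⟨hx, h⟩, fun h => h.2⟩
  have hm1 : MeasurableSet {y | g < y ∧ y - g ∈ B} :=
    measurableSet_Ioi.inter (hB.preimage (measurable_id.sub_const g))
  have hm2 : MeasurableSet (Set.Ioi 0 ∩ B) := measurableSet_Ioi.inter hB
  rw [hpos, expMeasure_eq_withDensity, withDensity_apply _ hm1, withDensity_apply _ hm2,
    ← lintegral_indicator hm1, ← lintegral_indicator hm2,
    ← lintegral_add_right_eq_self _ g, ← lintegral_const_mul]
  · refine lintegral_congr fun x => ?_
    by_cases hx : x ∈ Set.Ioi 0 ∩ B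
    · have hx0 : 0 < x := hx.1
      rw [Set.indicator_of_mem hx, Set.indicator_of_mem (by
        refine ⟨?_, ?_⟩
        · linarith
        · rw [add_sub_cancel_right]; exact hx.2), exponentialPDF_of_nonneg (by linarith),
        exponentialPDF_of_nonneg hx0.le, ← ENNReal.ofReal_mul (Real.exp_pos _).le]
      congr 1
      rw [mul_add, neg_add, Real.exp_add]; ring
    · rw [Set.indicator_of_notMem hx, Set.indicator_of_notMem, mul_zero]
      rintro ⟨h1, h2⟩
      rw [add_sub_cancel_right] at h2
      exact hx ⟨by simpa using h1, h2⟩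
  · exact (measurable_exponentialPDF r).indicator hm2

/-- In the race, `exp (-(q * x))` is the probability that the other clocks, of total rate `q`, are
all silent up to time `x`; the value is then the winning probability of the clock of rate `r`. -/
lemma lintegral_exp_neg_mul (hr : 0 < r) {q : ℝ} (hq : 0 ≤ q) :
    ∫⁻ x, ENNReal.ofReal (Real.exp (-(q * x))) ∂expMeasure r = ENNReal.ofReal (r / (r + q)) := by
  have hrq : 0 < r + q := by linarith
  rw [lintegral_expMeasure r (by fun_prop)]
  have : ∀ x, exponentialPDF r x * ENNReal.ofReal (Real.exp (-(q * x))) =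
      ENNReal.ofReal (r / (r + q)) * exponentialPDF (r + q) x := by
    intro x
    rcases lt_or_ge x 0 with hx | hx
    · rw [exponentialPDF_of_neg hx, exponentialPDF_of_neg hx]; simp
    · rw [exponentialPDF_of_nonneg hx, exponentialPDF_of_nonneg hx,
        ← ENNReal.ofReal_mul (by positivity), ← ENNReal.ofReal_mul (by positivity)]
      congr 1
      have : Real.exp (-((r + q) * x)) = Real.exp (-(r * x)) * Real.exp (-(q * x)) := by
        rw [← Real.exp_add]; ring_nf
      rw [this]
      field_simp
  simp_rw [this]
  rw [lintegral_const_mul _ (measurable_exponentialPDF _), lintegral_exponentialPDF_eq_one hrq,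
    mul_one]

lemma lintegral_id_expMeasure (hr : 0 < r) :
    ∫⁻ x, ENNReal.ofReal x ∂expMeasure r = ENNReal.ofReal r⁻¹ := by
  rw [lintegral_expMeasure r (by fun_prop)]
  -- Up to the factor `r⁻¹`, the size-biased exponential density is the gamma density of shape 2,
  -- whose total mass is 1.
  have : ∀ x, exponentialPDF r x * ENNReal.ofReal x = ENNReal.ofReal r⁻¹ * gammaPDF 2 r x := by
    intro x
    rcases lt_or_ge x 0 with hx | hx
    · rw [exponentialPDF_of_neg hx, gammaPDF_of_neg hx]; simp
    · rw [exponentialPDF_of_nonneg hx, gammaPDF_of_nonneg hx,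
        ← ENNReal.ofReal_mul (by positivity), ← ENNReal.ofReal_mul (by positivity)]
      congr 1
      have h2 : (2 : ℝ) - 1 = 1 := by norm_num
      rw [Real.Gamma_two, h2, Real.rpow_one, Real.rpow_two]
      field_simp
  simp_rw [this]
  rw [lintegral_const_mul _ (show Measurable (gammaPDF 2 r) from
    (measurable_gammaPDFReal 2 r).ennreal_ofReal), lintegral_gammaPDF_eq_one two_pos hr, mul_one]

lemma integrable_id_expMeasure (hr : 0 < r) : Integrable (fun x : ℝ => x) (expMeasure r) := by
  refine ⟨by fun_prop, ?_⟩
  rw [HasFiniteIntegral, lintegral_congr_ae (g := fun x => ENNReal.ofReal x),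
    lintegral_id_expMeasure hr]
  · exact ENNReal.ofReal_lt_top
  · filter_upwards [ae_pos_expMeasure r] with x hx
    rw [Real.enorm_of_nonneg hx.le]

lemma integral_id_expMeasure (hr : 0 < r) : ∫ x, x ∂expMeasure r = r⁻¹ := by
  rw [integral_eq_lintegral_of_nonneg_ae, lintegral_id_expMeasure hr,
    ENNReal.toReal_ofReal (by positivity)]
  · filter_upwards [ae_pos_expMeasure r] with x hx using hx.le
  · fun_prop

end Exponential

/-! ### Sequences of gaps -/

/-- The sequence with first term `y` followed by `z`. -/
def gapCons (y : ℝ) (z : ℕ → ℝ) : ℕ → ℝ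
  | 0 => y
  | n + 1 => z n

/-- The sequence without its first term. -/
def gapTail (x : ℕ → ℝ) : ℕ → ℝ := fun n => x (n + 1)

/-- Reduce the first term by `g`. -/
def gapLower (g : ℝ) (x : ℕ → ℝ) : ℕ → ℝ := gapCons (x 0 - g) (gapTail x)

lemma measurable_gapCons : Measurable fun q : ℝ × (ℕ → ℝ) => gapCons q.1 q.2 := by
  refine measurable_pi_lambda _ fun n => ?_
  cases n with
  | zero => exact measurable_fst
  | succ n => exact (measurable_pi_apply n).comp measurable_snd

lemma measurable_gapTail : Measurable gapTail :=
  measurable_pi_lambda _ fun n => measurable_pi_apply (n + 1)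

lemma measurable_gapLower : Measurable fun q : ℝ × (ℕ → ℝ) => gapLower q.1 q.2 :=
  measurable_gapCons.comp ((((measurable_pi_apply 0).comp measurable_snd).sub measurable_fst).prodMk
    (measurable_gapTail.comp measurable_snd))

/-- Prepending an independent term preserves an i.i.d. law. This allows the first gap to be treated
separately by Fubini. -/
lemma map_gapCons (m : Measure ℝ) [IsProbabilityMeasure m] :
    (m.prod (Measure.infinitePi fun _ : ℕ => m)).map (fun q => gapCons q.1 q.2) =
      Measure.infinitePi fun _ : ℕ => m := by
  classical
  refine Measure.eq_infinitePi _ fun s t ht => ?_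
  set t' : ℕ → Set ℝ := fun i => if i ∈ s then t i else Set.univ with ht'
  have hmt' : ∀ i, MeasurableSet (t' i) := by
    intro i; simp only [ht']; split_ifs
    exacts [ht i, MeasurableSet.univ]
  -- The cylinder is padded with `Set.univ` to an initial segment of indices, on which removing the
  -- first term is a plain shift.
  obtain ⟨N, hN⟩ : ∃ N, s ⊆ Finset.range (N + 1) :=
    ⟨s.sup id, fun i hi => Finset.mem_range.2 (Nat.lt_succ_of_le (Finset.le_sup (f := id) hi))⟩
  have hset : Set.pi (s : Set ℕ) t = Set.pi (Finset.range (N + 1) : Set ℕ) t' := by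
    ext x
    simp only [Set.mem_pi, ht']
    constructor
    · intro h i _
      split_ifs with hi
      · exact h i hi
      · trivial
    · intro h i hi
      have := h i (hN hi)
      rwa [if_pos (by exact hi)] at this
  have hprod : ∏ i ∈ s, m (t i) = ∏ i ∈ Finset.range (N + 1), m (t' i) := by
    rw [← Finset.prod_subset hN]
    · exact Finset.prod_congr rfl fun i hi => by simp [ht', hi]
    · intro i _ hi; simp [ht', hi]
  have hpre : (fun q : ℝ × (ℕ → ℝ) => gapCons q.1 q.2) ⁻¹'
      Set.pi (Finset.range (N + 1) : Set ℕ) t' =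
      t' 0 ×ˢ Set.pi (Finset.range N : Set ℕ) (fun n => t' (n + 1)) := by
    ext q
    simp only [Set.mem_preimage, Set.mem_pi, Set.mem_prod, Finset.coe_range, Set.mem_Iio]
    constructor
    · intro h
      exact ⟨h 0 (by omega), fun n hn => h (n + 1) (by omega)⟩
    · rintro ⟨h0, h1⟩ i hi
      cases i with
      | zero => exact h0
      | succ n => exact h1 n (by omega)
  have hms : MeasurableSet (Set.pi (Finset.range (N + 1) : Set ℕ) t') :=
    MeasurableSet.pi (Set.to_countable _) fun i _ => hmt' i
  rw [hset, Measure.map_apply measurable_gapCons hms, hpre, Measure.prod_prod,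
    Measure.infinitePi_pi _ (fun i _ => hmt' (i + 1)), hprod, Finset.prod_range_succ', mul_comm]

lemma lintegral_head_mul_tail (m : Measure ℝ) [IsProbabilityMeasure m] {f : ℝ → ℝ≥0∞}
    {h : (ℕ → ℝ) → ℝ≥0∞} (hf : Measurable f) (hh : Measurable h) :
    ∫⁻ x, f (x 0) * h (gapTail x) ∂Measure.infinitePi (fun _ : ℕ => m) =
      (∫⁻ y, f y ∂m) * ∫⁻ z, h z ∂Measure.infinitePi (fun _ : ℕ => m) := by
  conv_lhs => rw [← map_gapCons m]
  rw [lintegral_map _ measurable_gapCons]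
  · exact lintegral_prod_mul hf.aemeasurable hh.aemeasurable
  · exact (hf.comp (measurable_pi_apply 0)).mul (hh.comp measurable_gapTail)

/-- The law of the sequence of gaps of a Poissonian flow. -/
noncomputable def gapLaw (r : ℝ) : Measure (ℕ → ℝ) := Measure.infinitePi fun _ : ℕ => expMeasure r

lemma isProbabilityMeasure_gapLaw {r : ℝ} (hr : 0 < r) : IsProbabilityMeasure (gapLaw r) := by
  have := isProbabilityMeasure_expMeasure hr
  unfold gapLaw; infer_instance

lemma ae_head_pos_gapLaw {r : ℝ} (hr : 0 < r) : ∀ᵐ x ∂gapLaw r, 0 < x 0 := by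
  have := isProbabilityMeasure_expMeasure hr
  exact (measurePreserving_eval_infinitePi (fun _ : ℕ => expMeasure r) 0).quasiMeasurePreserving.ae
    (ae_pos_expMeasure r)

lemma gapLaw_memoryless {r : ℝ} (hr : 0 < r) {g : ℝ} (hg : 0 ≤ g) {B : Set (ℕ → ℝ)}
    (hB : MeasurableSet B) :
    gapLaw r {x | g < x 0 ∧ gapLower g x ∈ B} =
      ENNReal.ofReal (Real.exp (-(r * g))) * gapLaw r B := by
  have hP := isProbabilityMeasure_expMeasure hr
  have hS : MeasurableSet {x : ℕ → ℝ | g < x 0 ∧ gapLower g x ∈ B} := by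
    refine (measurableSet_lt measurable_const (measurable_pi_apply 0)).inter ?_
    exact hB.preimage (measurable_gapLower.comp (measurable_const.prodMk measurable_id))
  have hB' : MeasurableSet ((fun q : ℝ × (ℕ → ℝ) => gapCons q.1 q.2) ⁻¹' B) :=
    measurable_gapCons hB
  have hS' := measurable_gapCons hS
  unfold gapLaw
  rw [← map_gapCons, Measure.map_apply measurable_gapCons hS,
    Measure.map_apply measurable_gapCons hB, Measure.prod_apply_symm hS',
    Measure.prod_apply_symm hB', ← lintegral_const_mul _ (measurable_measure_prodMk_right hB')]
  refine lintegral_congr fun z => ?_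
  exact expMeasure_memoryless hg (measurable_prodMk_right hB')

/-! ### The race of exponential clocks -/

section Race
variable {ι : Type*} [DecidableEq ι]

/-- The gaps seen from the first instant of the flow `i`. -/
def advance (i : ι) (G : ι → ℕ → ℝ) : ι → ℕ → ℝ :=
  fun j => if j = i then gapTail (G i) else gapLower (G i 0) (G j)

lemma measurable_advance (i : ι) : Measurable (advance i) := by
  refine measurable_pi_lambda _ fun j => ?_
  by_cases h : j = i
  · simp only [advance, h, if_true]
    exact measurable_gapTail.comp (measurable_pi_apply i)
  · simp only [advance, h, if_false]
    have hm : Measurable fun G : ι → ℕ → ℝ => (G i 0, G j) :=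
      ((measurable_pi_apply 0).comp (measurable_pi_apply i)).prodMk (measurable_pi_apply j)
    exact measurable_gapLower.comp hm

variable [Fintype ι]

/-- Condition on the gaps of flow `i`, with first gap `y`. By lack of memory each other flow `j`
contributes `exp (-(r j * y))` times the measure of `B j`. The product of exponentials is `exp (-(q
* y))`, with `q` the sum of the other rates; it integrates to `r i / (r i + q)`, independently of
the tail of flow `i`. -/
lemma race_box (r : ι → ℝ) (hr : ∀ i, 0 < r i) (i : ι) {B : ι → Set (ℕ → ℝ)}
    (hB : ∀ j, MeasurableSet (B j)) :
    Measure.pi (fun j => gapLaw (r j))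
      {G | (∀ j, j ≠ i → G i 0 < G j 0) ∧ advance i G ∈ Set.univ.pi B} =
      ENNReal.ofReal (r i / ∑ j, r j) * ∏ j, gapLaw (r j) (B j) := by
  have hP := fun j => isProbabilityMeasure_gapLaw (hr j)
  have hPe := fun j => isProbabilityMeasure_expMeasure (hr j)
  have hmp := measurePreserving_piEquivPiSubtypeProd (fun j => gapLaw (r j)) (fun j => j = i)
  set F : Set (({j // j = i} → ℕ → ℝ) × ({j // ¬ j = i} → ℕ → ℝ)) :=
    {x | gapTail (x.1 ⟨i, rfl⟩) ∈ B i ∧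
      ∀ j, x.1 ⟨i, rfl⟩ 0 < x.2 j 0 ∧ gapLower (x.1 ⟨i, rfl⟩ 0) (x.2 j) ∈ B j} with hF
  have m1 : Measurable fun x : ({j // j = i} → ℕ → ℝ) × ({j // ¬ j = i} → ℕ → ℝ) =>
      x.1 ⟨i, rfl⟩ := (measurable_pi_apply _).comp measurable_fst
  have m2 : ∀ j, Measurable fun x : ({j // j = i} → ℕ → ℝ) × ({j // ¬ j = i} → ℕ → ℝ) =>
      x.2 j := fun j => (measurable_pi_apply _).comp measurable_snd
  have hFm : MeasurableSet F := by
    have hS : MeasurableSet {x : ({j // j = i} → ℕ → ℝ) × ({j // ¬ j = i} → ℕ → ℝ) |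
        ∀ j, x.1 ⟨i, rfl⟩ 0 < x.2 j 0 ∧ gapLower (x.1 ⟨i, rfl⟩ 0) (x.2 j) ∈ B j} := by
      rw [Set.ofPred_forall]
      refine MeasurableSet.iInter fun j => ?_
      refine (measurableSet_lt ((measurable_pi_apply 0).comp m1)
        ((measurable_pi_apply 0).comp (m2 j))).inter ?_
      exact (measurable_gapLower.comp (((measurable_pi_apply 0).comp m1).prodMk (m2 j))) (hB j)
    exact (measurable_gapTail.comp m1 (hB i)).inter hS
  have hset : {G | (∀ j, j ≠ i → G i 0 < G j 0) ∧ advance i G ∈ Set.univ.pi B} =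
      MeasurableEquiv.piEquivPiSubtypeProd (fun _ : ι => ℕ → ℝ) (fun j => j = i) ⁻¹' F := by
    ext G
    simp only [Set.mem_ofPred_eq, Set.mem_preimage, hF, Set.mem_univ_pi, advance,
      MeasurableEquiv.piEquivPiSubtypeProd, Equiv.piEquivPiSubtypeProd, MeasurableEquiv.coe_mk,
      Equiv.coe_fn_mk, Subtype.forall]
    constructor
    · rintro ⟨h1, h2⟩
      refine ⟨by simpa using h2 i, fun j hj => ⟨h1 j hj, by simpa [hj] using h2 j⟩⟩
    · rintro ⟨h1, h2⟩
      refine ⟨fun j hj => (h2 j hj).1, fun j => ?_⟩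
      by_cases hj : j = i
      · subst hj; simpa using h1
      · simpa [hj] using (h2 j hj).2
  rw [hset, hmp.measure_preimage hFm.nullMeasurableSet, Measure.prod_apply hFm]
  set h : (ℕ → ℝ) → ℝ≥0∞ := fun y => (B i).indicator 1 (gapTail y) *
    ∏ j : {j // ¬ j = i}, gapLaw (r j) {z | y 0 < z 0 ∧ gapLower (y 0) z ∈ B j} with hh
  have hsec : ∀ x : {j // j = i} → ℕ → ℝ,
      Measure.pi (fun j : {j // ¬ j = i} => gapLaw (r j)) (Prod.mk x ⁻¹' F) = h (x ⟨i, rfl⟩) := by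
    intro x
    by_cases hx : gapTail (x ⟨i, rfl⟩) ∈ B i
    · have : Prod.mk x ⁻¹' F = Set.univ.pi fun j : {j // ¬ j = i} =>
          {z | x ⟨i, rfl⟩ 0 < z 0 ∧ gapLower (x ⟨i, rfl⟩ 0) z ∈ B j} := by
        ext y
        simp only [hF, Set.mem_preimage, Set.mem_ofPred_eq, hx, true_and, Set.mem_univ_pi]
      rw [this, Measure.pi_pi, hh]
      simp [hx]
    · have : Prod.mk x ⁻¹' F = ∅ := by
        ext y
        simp [hF, hx]
      rw [this, hh]
      simp [hx]
  simp_rw [hsec]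
  have hu := measurePreserving_piUnique (fun j : {j // j = i} => gapLaw (r j))
  have hcomp := hu.lintegral_comp_emb (MeasurableEquiv.measurableEmbedding _) h
  have hstep : ∫⁻ x, h (x ⟨i, rfl⟩) ∂(Measure.pi fun j : {j // j = i} => gapLaw (r j)) =
      ∫⁻ y, h y ∂gapLaw (r i) := hcomp
  refine Eq.trans (b := ∫⁻ y, h y ∂gapLaw (r i)) (by convert hstep) ?_
  set q : ℝ := ∑ j : {j // ¬ j = i}, r j with hq
  have hq0 : 0 ≤ q := Finset.sum_nonneg fun j _ => (hr j).le
  have hae : h =ᵐ[gapLaw (r i)] fun y => ENNReal.ofReal (Real.exp (-(q * y 0))) *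
      ((B i).indicator 1 (gapTail y) * ∏ j : {j // ¬ j = i}, gapLaw (r j) (B j)) := by
    filter_upwards [ae_head_pos_gapLaw (hr i)] with y hy
    simp only [hh]
    rw [Finset.prod_congr rfl fun (j : {j // ¬ j = i}) _ =>
      gapLaw_memoryless (hr j) hy.le (hB j), Finset.prod_mul_distrib,
      ← ENNReal.ofReal_prod_of_nonneg (fun _ _ => (Real.exp_pos _).le), ← Real.exp_sum,
      Finset.sum_neg_distrib, ← Finset.sum_mul]
    ring
  rw [lintegral_congr_ae hae]
  have hsplit := lintegral_head_mul_tail (expMeasure (r i))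
    (f := fun g => ENNReal.ofReal (Real.exp (-(q * g))))
    (h := fun z => (B i).indicator 1 z * ∏ j : {j // ¬ j = i}, gapLaw (r j) (B j))
    (by fun_prop) ((measurable_one.indicator (hB i)).mul_const _)
  refine hsplit.trans ?_
  rw [lintegral_exp_neg_mul (hr i) hq0, lintegral_mul_const _ (measurable_one.indicator (hB i)),
    lintegral_indicator_one (hB i)]
  have e1 : r i + q = ∑ j, r j := by
    rw [hq, Fintype.sum_eq_add_sum_subtype_ne r i]
  have e2 : gapLaw (r i) (B i) * ∏ j : {j // ¬ j = i}, gapLaw (r j) (B j) =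
      ∏ j, gapLaw (r j) (B j) := by
    rw [Fintype.prod_eq_mul_prod_subtype_ne (fun j => gapLaw (r j) (B j)) i]
  rw [e1, ← e2]
  rfl

/-- The flow whose first gap is the smallest one is the flow `i` with probability proportional
to its intensity, and the gaps seen from that instant have the original law. -/
theorem race (r : ι → ℝ) (hr : ∀ i, 0 < r i) (i : ι) {A : Set (ι → ℕ → ℝ)}
    (hA : MeasurableSet A) :
    Measure.pi (fun j => gapLaw (r j)) {G | (∀ j, j ≠ i → G i 0 < G j 0) ∧ advance i G ∈ A} =
      ENNReal.ofReal (r i / ∑ j, r j) * Measure.pi (fun j => gapLaw (r j)) A := by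
  have hP := fun j => isProbabilityMeasure_gapLaw (hr j)
  set μ := Measure.pi (fun j => gapLaw (r j)) with hμ
  have hW : MeasurableSet {G : ι → ℕ → ℝ | ∀ j, j ≠ i → G i 0 < G j 0} := by
    simp only [Set.ofPred_forall]
    refine MeasurableSet.iInter fun j => MeasurableSet.iInter fun _ => ?_
    exact measurableSet_lt ((measurable_pi_apply 0).comp (measurable_pi_apply i))
      ((measurable_pi_apply 0).comp (measurable_pi_apply j))
  have hsum : 0 < ∑ j, r j := Finset.sum_pos (fun j _ => hr j) ⟨i, Finset.mem_univ i⟩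
  set c : ℝ≥0∞ := ENNReal.ofReal (r i / ∑ j, r j) with hc
  have hc0 : c ≠ 0 := by
    rw [hc, ← pos_iff_ne_zero, ENNReal.ofReal_pos]
    exact div_pos (hr i) hsum
  have hcT : c ≠ ∞ := ENNReal.ofReal_ne_top
  set ν := (μ.restrict {G : ι → ℕ → ℝ | ∀ j, j ≠ i → G i 0 < G j 0}).map (advance i) with hν
  have happ : ∀ {A : Set (ι → ℕ → ℝ)}, MeasurableSet A →
      ν A = μ {G | (∀ j, j ≠ i → G i 0 < G j 0) ∧ advance i G ∈ A} := by
    intro A hA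
    rw [hν, Measure.map_apply (measurable_advance i) hA,
      Measure.restrict_apply (measurable_advance i hA), Set.inter_comm]
    rfl
  -- The values on boxes characterize a product measure, so the box case identifies the normalized
  -- image measure with `μ`.
  have heq : μ = c⁻¹ • ν := by
    refine Measure.pi_eq fun B hB => ?_
    rw [Measure.smul_apply, happ (MeasurableSet.univ_pi hB), hμ, race_box r hr i hB, smul_eq_mul,
      ← mul_assoc, ENNReal.inv_mul_cancel hc0 hcT, one_mul]
  rw [← happ hA]
  conv_rhs => rw [heq]
  rw [Measure.smul_apply, smul_eq_mul, ← mul_assoc, ENNReal.mul_inv_cancel hc0 hcT, one_mul]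

end Race

/-! ### Realizations of the three flows -/

/-- A realization of the three flows without accumulation points and without common instants. -/
structure Regular (s : Source → ℕ → ℝ) : Prop where
  zero : ∀ c, s c 0 = 0
  mono : ∀ c, StrictMono (s c)
  lim : ∀ c, Tendsto (s c) atTop atTop
  ne : ∀ c c', c ≠ c' → ∀ m n, s c (m + 1) ≠ s c' (n + 1)

/-- The instants of the three flows after time `u`. -/
def instantsAfter (s : Source → ℕ → ℝ) (u : ℝ) : Set ℝ := {t : ℝ | u < t ∧ ∃ c, IsInstant s c t}

lemma eventTime_succ_eq {s : Source → ℕ → ℝ} {n : ℕ} {a : ℝ}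
    (h : IsLeast (instantsAfter s (eventTime s n)) a) : eventTime s (n + 1) = a :=
  h.csInf_eq

namespace Regular

variable {s : Source → ℕ → ℝ}

lemma finite_instants (h : Regular s) (M : ℝ) : {t : ℝ | t ≤ M ∧ ∃ c, IsInstant s c t}.Finite := by
  have hc : ∀ c, {t : ℝ | t ≤ M ∧ IsInstant s c t}.Finite := by
    intro c
    obtain ⟨N, hN⟩ := (h.lim c).eventually (eventually_gt_atTop M) |>.exists_forall_of_atTop
    refine ((Set.finite_Iio N).image (s c)).subset ?_
    rintro t ⟨ht, n, rfl⟩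
    refine ⟨n + 1, ?_, rfl⟩
    by_contra hn
    exact absurd (hN (n + 1) (by simpa using hn)) (not_lt.2 ht)
  refine (Set.finite_iUnion hc).subset ?_
  rintro t ⟨ht, c, hct⟩
  exact Set.mem_iUnion.2 ⟨c, ht, hct⟩

/-- The infimum defining the next event time is attained, because later instants exist and only
finitely many lie below any bound. -/
lemma isLeast_eventTime (h : Regular s) (n : ℕ) :
    IsLeast (instantsAfter s (eventTime s n)) (eventTime s (n + 1)) := by
  set u := eventTime s n with hu
  obtain ⟨N, hN⟩ := ((h.lim .message).eventually (eventually_gt_atTop u)).exists_forall_of_atTop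
  set t₀ := s .message (N + 1) with ht₀
  have ht₀S : t₀ ∈ instantsAfter s u := ⟨hN _ (Nat.le_succ N), .message, N, rfl⟩
  have hfin : (instantsAfter s u ∩ Set.Iic t₀).Finite :=
    (h.finite_instants t₀).subset fun t ht => ⟨ht.2, ht.1.2⟩
  obtain ⟨a, ha, hmin⟩ := Set.exists_min_image _ id hfin ⟨t₀, ht₀S, Set.mem_Iic.2 le_rfl⟩
  have hleast : IsLeast (instantsAfter s u) a := by
    refine ⟨ha.1, fun t ht => ?_⟩
    rcases le_total t t₀ with h1 | h1
    · exact hmin t ⟨ht, h1⟩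
    · exact le_trans ha.2 h1
  rwa [eventTime_succ_eq hleast]

lemma eventTime_strictMono (h : Regular s) : StrictMono (eventTime s) :=
  strictMono_nat_of_lt_succ fun n => (h.isLeast_eventTime n).1.1

lemma eventTime_nonneg (h : Regular s) (n : ℕ) : 0 ≤ eventTime s n :=
  h.eventTime_strictMono.monotone (Nat.zero_le n)

lemma exists_lt_eventTime (h : Regular s) (M : ℝ) : ∃ n, M < eventTime s n := by
  by_contra! hcon
  have hinj : Function.Injective fun n => eventTime s (n + 1) := fun m n hmn => by
    simpa using h.eventTime_strictMono.injective hmn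
  refine Set.infinite_of_injective_forall_mem hinj (s := {t : ℝ | t ≤ M ∧ ∃ c, IsInstant s c t})
    (fun n => ?_) (h.finite_instants M)
  exact ⟨hcon _, (h.isLeast_eventTime n).1.2⟩

/-- Any time lies between two successive events. -/
lemma exists_between_eventTime (h : Regular s) {t : ℝ} (ht : 0 ≤ t) :
    ∃ n, eventTime s n ≤ t ∧ t < eventTime s (n + 1) := by
  classical
  have hex := h.exists_lt_eventTime t
  have hpos : Nat.find hex ≠ 0 := by
    intro h0
    have := Nat.find_spec hex
    rw [h0] at this
    exact absurd this (not_lt.2 ht)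
  obtain ⟨n, hn⟩ := Nat.exists_eq_succ_of_ne_zero hpos
  refine ⟨n, not_lt.1 (Nat.find_min hex (by omega)), ?_⟩
  have := Nat.find_spec hex
  rwa [hn] at this

lemma stateAt_eq (h : Regular s) (x₀ : ℤ × ℤ) {t : ℝ} {n : ℕ} (h1 : eventTime s n ≤ t)
    (h2 : t < eventTime s (n + 1)) : stateAt s x₀ t = stateAfter s x₀ n := by
  have : {k : ℕ | 0 < k ∧ eventTime s k ≤ t} = (Finset.Icc 1 n : Set ℕ) := by
    ext k
    simp only [Set.mem_ofPred_eq, Finset.coe_Icc, Set.mem_Icc]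
    refine ⟨fun ⟨hk, hkt⟩ => ⟨hk, ?_⟩, fun ⟨hk, hkn⟩ =>
      ⟨hk, (h.eventTime_strictMono.monotone hkn).trans h1⟩⟩
    have := h.eventTime_strictMono.lt_iff_lt.1 (hkt.trans_lt h2)
    omega
  rw [stateAt, this, Set.ncard_coe_finset, Nat.card_Icc, Nat.add_sub_cancel]

lemma stateAt_eventTime (h : Regular s) (x₀ : ℤ × ℤ) (n : ℕ) :
    stateAt s x₀ (eventTime s n) = stateAfter s x₀ n :=
  h.stateAt_eq x₀ le_rfl (h.eventTime_strictMono (Nat.lt_succ_self n))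

lemma eq_of_isInstant (h : Regular s) {c c' : Source} {t : ℝ} (hc : IsInstant s c t)
    (hc' : IsInstant s c' t) : c = c' := by
  by_contra hne
  obtain ⟨m, hm⟩ := hc
  obtain ⟨n, hn⟩ := hc'
  exact h.ne c c' hne m n (hm.trans hn.symm)

lemma actAt_actAt_actAt (h : Regular s) {c : Source} {t : ℝ} (hc : IsInstant s c t) (x : ℤ × ℤ) :
    actAt s t .message (actAt s t .update2 (actAt s t .update1 x)) = act c x := by
  have hno : ∀ c', c' ≠ c → ∀ y, actAt s t c' y = y := fun c' hc' y =>
    if_neg fun hi => hc' (h.eq_of_isInstant hi hc)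
  have hyes : ∀ y, actAt s t c y = act c y := fun y => if_pos hc
  cases c
  · rw [hno .message (by simp), hno .update2 (by simp), hyes]
  · rw [hno .message (by simp), hno .update1 (by simp), hyes]
  · rw [hno .update1 (by simp), hno .update2 (by simp), hyes]

/-- Exactly one flow has an instant at any event time, and this event changes the state. -/
lemma exists_type (h : Regular s) (n : ℕ) : ∃ c, IsInstant s c (eventTime s (n + 1)) ∧
    (∀ c', IsInstant s c' (eventTime s (n + 1)) ↔ c' = c) ∧
    ∀ x₀, stateAfter s x₀ (n + 1) = act c (stateAfter s x₀ n) := by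
  obtain ⟨c, hc⟩ := (h.isLeast_eventTime n).1.2
  refine ⟨c, hc, fun c' => ⟨fun h' => h.eq_of_isInstant h' hc, fun h' => h' ▸ hc⟩, fun x₀ => ?_⟩
  rw [stateAfter, h.actAt_actAt_actAt hc]

end Regular

/-! ### The counting functions of the flows -/

/-- The number of instants of the flow `c` up to time `t`. -/
noncomputable def flowCount (s : Source → ℕ → ℝ) (c : Source) (t : ℝ) : ℕ :=
  Set.ncard {n : ℕ | s c (n + 1) ≤ t}

namespace Regular

variable {s : Source → ℕ → ℝ}

lemma flowCount_eq (h : Regular s) {c : Source} {t : ℝ} {k : ℕ} (h1 : s c k ≤ t)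
    (h2 : t < s c (k + 1)) : flowCount s c t = k := by
  have : {n : ℕ | s c (n + 1) ≤ t} = (Finset.range k : Set ℕ) := by
    ext n
    simp only [Set.mem_ofPred_eq, Finset.coe_range, Set.mem_Iio]
    refine ⟨fun hn => ?_, fun hn => ((h.mono c).monotone (by omega)).trans h1⟩
    have := (h.mono c).lt_iff_lt.1 (hn.trans_lt h2)
    omega
  rw [flowCount, this, Set.ncard_coe_finset, Finset.card_range]

lemma flowCount_spec (h : Regular s) (c : Source) {t : ℝ} (ht : 0 ≤ t) :
    s c (flowCount s c t) ≤ t ∧ t < s c (flowCount s c t + 1) := by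
  classical
  have hex : ∃ n, t < s c n := ((h.lim c).eventually (eventually_gt_atTop t)).exists
  have hpos : Nat.find hex ≠ 0 := by
    intro h0
    have := Nat.find_spec hex
    rw [h0, h.zero] at this
    exact absurd this (not_lt.2 ht)
  obtain ⟨n, hn⟩ := Nat.exists_eq_succ_of_ne_zero hpos
  have h1 : s c n ≤ t := not_lt.1 (Nat.find_min hex (by omega))
  have h2 : t < s c (n + 1) := by
    have := Nat.find_spec hex
    rwa [hn] at this
  rw [h.flowCount_eq h1 h2]
  exact ⟨h1, h2⟩

lemma flowCount_zero (h : Regular s) (c : Source) : flowCount s c 0 = 0 :=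
  h.flowCount_eq (h.zero c).le (by rw [← h.zero c]; exact h.mono c Nat.zero_lt_one)

lemma flowCount_of_between (h : Regular s) (c : Source) {t : ℝ} {n : ℕ}
    (h1 : eventTime s n ≤ t) (h2 : t < eventTime s (n + 1)) :
    flowCount s c t = flowCount s c (eventTime s n) := by
  obtain ⟨a1, a2⟩ := h.flowCount_spec c (h.eventTime_nonneg n)
  refine h.flowCount_eq (a1.trans h1) (h2.trans_le ?_)
  exact (h.isLeast_eventTime n).2 ⟨a2, c, _, rfl⟩

open Classical in
lemma flowCount_eventTime_succ (h : Regular s) (c : Source) (n : ℕ) :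
    flowCount s c (eventTime s (n + 1)) = flowCount s c (eventTime s n) +
      if IsInstant s c (eventTime s (n + 1)) then 1 else 0 := by
  obtain ⟨a1, a2⟩ := h.flowCount_spec c (h.eventTime_nonneg n)
  set k := flowCount s c (eventTime s n) with hk
  have hle : eventTime s (n + 1) ≤ s c (k + 1) := (h.isLeast_eventTime n).2 ⟨a2, c, _, rfl⟩
  have hlt : eventTime s n < eventTime s (n + 1) := h.eventTime_strictMono (Nat.lt_succ_self n)
  split_ifs with hi
  · obtain ⟨m, hm⟩ := hi
    have hkm : k < m + 1 := (h.mono c).lt_iff_lt.1 (by rw [hm]; exact a1.trans_lt hlt)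
    have hmk : m + 1 ≤ k + 1 := (h.mono c).le_iff_le.1 (by rw [hm]; exact hle)
    have hmk' : m = k := by omega
    subst hmk'
    exact h.flowCount_eq hm.le (by rw [← hm]; exact h.mono c (Nat.lt_succ_self _))
  · refine h.flowCount_eq (a1.trans hlt.le) (lt_of_le_of_ne hle fun he => hi ⟨k, he.symm⟩)

lemma flowCount_eventTime_of_type (h : Regular s) {c : Source} {n : ℕ}
    (hc : ∀ c', IsInstant s c' (eventTime s (n + 1)) ↔ c' = c) (c' : Source) :
    flowCount s c' (eventTime s (n + 1)) = flowCount s c' (eventTime s n) +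
      if c' = c then 1 else 0 := by
  rw [h.flowCount_eventTime_succ]
  simp only [hc]

end Regular

/-! ### Pathwise bounds -/

/-- The difference `x₂ - x₁` of the local times of a state. -/
def lag (x : ℤ × ℤ) : ℤ := x.2 - x.1

lemma lag_act (c : Source) (x : ℤ × ℤ) : lag (act c x) = step c (lag x) := by
  cases c <;> simp only [lag, act, step]
  · omega
  · omega
  · split_ifs <;> omega

namespace Regular

variable {s : Source → ℕ → ℝ} (h : Regular s) (x₀ : ℤ × ℤ)
include h

lemma fst_stateAfter (n : ℕ) :
    (stateAfter s x₀ n).1 = x₀.1 + flowCount s .update1 (eventTime s n) := by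
  induction n with
  | zero => simp [stateAfter, eventTime, h.flowCount_zero]
  | succ n ih =>
    obtain ⟨c, -, hc, hx⟩ := h.exists_type n
    rw [hx, h.flowCount_eventTime_of_type hc]
    cases c <;> simp [act, ih, add_assoc]

/-- Messages never increase the lag, so the walk without messages dominates it. -/
lemma lag_stateAfter_le (n : ℕ) :
    lag (stateAfter s x₀ n) ≤ lag x₀ + flowCount s .update2 (eventTime s n) -
      flowCount s .update1 (eventTime s n) := by
  induction n with
  | zero => simp [stateAfter, eventTime, h.flowCount_zero]
  | succ n ih =>
    obtain ⟨c, -, hc, hx⟩ := h.exists_type n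
    rw [hx, lag_act, h.flowCount_eventTime_of_type hc, h.flowCount_eventTime_of_type hc]
    cases c <;> simp [step] <;> omega

/-- A reflection bound: `m` is the last index at which the lag is nonnegative, or 0 if there is
none. After it the lag stays negative, messages have no effect, and the lag moves like the free
walk. -/
lemma exists_le_lag_stateAfter (n : ℕ) : ∃ m ≤ n,
    min (lag x₀) 0 + ((flowCount s .update2 (eventTime s n) : ℤ) -
      flowCount s .update1 (eventTime s n)) - ((flowCount s .update2 (eventTime s m) : ℤ) -
      flowCount s .update1 (eventTime s m)) ≤ lag (stateAfter s x₀ n) := by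
  induction n with
  | zero => exact ⟨0, le_rfl, by simp [stateAfter]⟩
  | succ n ih =>
    obtain ⟨m, hm, ih⟩ := ih
    obtain ⟨c, -, hc, hx⟩ := h.exists_type n
    have e := h.flowCount_eventTime_of_type hc
    rcases lt_or_ge (lag (stateAfter s x₀ (n + 1))) 0 with hneg | hnn
    · refine ⟨m, by omega, ?_⟩
      rw [hx, lag_act] at hneg ⊢
      rw [e, e]
      cases c <;> simp [step] at hneg ⊢ <;> omega
    · exact ⟨n + 1, le_rfl, by omega⟩

/-- Here `m` is the index of the last message, or 0 if there is none. A message leaves the lag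
nonpositive, and afterwards only updates of processor 2 raise it. -/
lemma exists_lag_stateAfter_le (n : ℕ) : ∃ m ≤ n,
    lag (stateAfter s x₀ n) ≤ max (lag x₀) 0 + flowCount s .update2 (eventTime s n) -
      flowCount s .update2 (eventTime s m) ∧
    flowCount s .message (eventTime s n) = flowCount s .message (eventTime s m) := by
  induction n with
  | zero => exact ⟨0, le_rfl, by simp [stateAfter]⟩
  | succ n ih =>
    obtain ⟨m, hm, ih, ih'⟩ := ih
    obtain ⟨c, -, hc, hx⟩ := h.exists_type n
    have e := h.flowCount_eventTime_of_type hc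
    by_cases hcm : c = .message
    · refine ⟨n + 1, le_rfl, ?_, rfl⟩
      rw [hx, lag_act, hcm]
      simp only [step]
      omega
    · refine ⟨m, by omega, ?_, ?_⟩
      · rw [hx, lag_act, e]
        cases c <;> simp [step] at hcm ⊢ <;> omega
      · rw [e, if_neg (Ne.symm hcm), ih', add_zero]

lemma fst_stateAt {t : ℝ} (ht : 0 ≤ t) : (stateAt s x₀ t).1 = x₀.1 + flowCount s .update1 t := by
  obtain ⟨n, h1, h2⟩ := h.exists_between_eventTime ht
  rw [h.stateAt_eq x₀ h1 h2, h.fst_stateAfter, h.flowCount_of_between _ h1 h2]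

lemma lag_stateAt_le {t : ℝ} (ht : 0 ≤ t) :
    lag (stateAt s x₀ t) ≤ lag x₀ + flowCount s .update2 t - flowCount s .update1 t := by
  obtain ⟨n, h1, h2⟩ := h.exists_between_eventTime ht
  rw [h.stateAt_eq x₀ h1 h2, h.flowCount_of_between _ h1 h2, h.flowCount_of_between _ h1 h2]
  exact h.lag_stateAfter_le x₀ n

lemma exists_le_lag_stateAt {t : ℝ} (ht : 0 ≤ t) : ∃ u, 0 ≤ u ∧ u ≤ t ∧
    min (lag x₀) 0 + ((flowCount s .update2 t : ℤ) - flowCount s .update1 t) -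
      ((flowCount s .update2 u : ℤ) - flowCount s .update1 u) ≤ lag (stateAt s x₀ t) := by
  obtain ⟨n, h1, h2⟩ := h.exists_between_eventTime ht
  obtain ⟨m, hm, hle⟩ := h.exists_le_lag_stateAfter x₀ n
  refine ⟨eventTime s m, h.eventTime_nonneg m,
    (h.eventTime_strictMono.monotone hm).trans h1, ?_⟩
  rwa [h.stateAt_eq x₀ h1 h2, h.flowCount_of_between _ h1 h2, h.flowCount_of_between _ h1 h2]

lemma exists_lag_stateAt_le {t : ℝ} (ht : 0 ≤ t) : ∃ u, 0 ≤ u ∧ u ≤ t ∧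
    lag (stateAt s x₀ t) ≤ max (lag x₀) 0 + flowCount s .update2 t - flowCount s .update2 u ∧
    flowCount s .message t = flowCount s .message u := by
  obtain ⟨n, h1, h2⟩ := h.exists_between_eventTime ht
  obtain ⟨m, hm, hle⟩ := h.exists_lag_stateAfter_le x₀ n
  refine ⟨eventTime s m, h.eventTime_nonneg m,
    (h.eventTime_strictMono.monotone hm).trans h1, ?_⟩
  rwa [h.stateAt_eq x₀ h1 h2, h.flowCount_of_between _ h1 h2, h.flowCount_of_between _ h1 h2]

end Regular

/-! ### Linear growth -/

/-- `f t = v t + o(t)`, with a bound which is uniform on compact sets. -/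
def LinearGrowth (f : ℝ → ℝ) (v : ℝ) : Prop :=
  ∀ ε > 0, ∃ K, ∀ t ≥ 0, |f t - v * t| ≤ ε * t + K

lemma LinearGrowth.tendsto {f : ℝ → ℝ} {v : ℝ} (h : LinearGrowth f v) :
    Tendsto (fun t => f t / t) atTop (𝓝 v) := by
  rw [Metric.tendsto_atTop]
  intro ε hε
  obtain ⟨K, hK⟩ := h (ε / 2) (by positivity)
  refine ⟨max 1 (2 * K / ε + 1), fun t ht => ?_⟩
  have ht1 : 1 ≤ t := (le_max_left _ _).trans ht
  have ht2 : 2 * K / ε < t := by linarith [(le_max_right _ _).trans ht]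
  have ht0 : 0 < t := by linarith
  rw [div_lt_iff₀ hε] at ht2
  rw [Real.dist_eq, show f t / t - v = (f t - v * t) / t by field_simp, abs_div, abs_of_pos ht0,
    div_lt_iff₀ ht0]
  have := hK t ht0.le
  nlinarith

/-- Inversion of the law of large numbers: the count `N` satisfies `s c N ≤ t < s c (N + 1)`, and `s
c n` is close to `n / r`. -/
lemma linearGrowth_flowCount {s : Source → ℕ → ℝ} (h : Regular s) {c : Source} {r : ℝ}
    (hr : 0 < r) (hlim : Tendsto (fun n : ℕ => s c n / n) atTop (𝓝 r⁻¹)) :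
    LinearGrowth (fun t => flowCount s c t) r := by
  intro ε hε
  -- This tolerance is chosen so that `r⁻¹ - δ = (r + ε)⁻¹`.
  have hδ : 0 < ε / (r * (r + ε)) := by positivity
  set δ := ε / (r * (r + ε)) with hδe
  obtain ⟨M, hM⟩ : ∃ M, ∀ n : ℕ, |s c n - n * r⁻¹| ≤ δ * n + M := by
    obtain ⟨N, hN⟩ := Metric.tendsto_atTop.1 hlim δ hδ
    refine ⟨∑ n ∈ Finset.range (N + 1), |s c n - n * r⁻¹|, fun n => ?_⟩
    rcases lt_or_ge n (N + 1) with hn | hn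
    · have : |s c n - n * r⁻¹| ≤ ∑ n ∈ Finset.range (N + 1), |s c n - n * r⁻¹| :=
        Finset.single_le_sum (f := fun n : ℕ => |s c n - n * r⁻¹|) (fun _ _ => abs_nonneg _)
          (Finset.mem_range.2 hn)
      have : 0 ≤ δ * n := by positivity
      linarith
    · have hn0 : (0 : ℝ) < n := by exact_mod_cast (by omega : 0 < n)
      have h1 := hN n (by omega)
      rw [Real.dist_eq, show s c n / n - r⁻¹ = (s c n - n * r⁻¹) / n by field_simp, abs_div,
        abs_of_pos hn0, div_lt_iff₀ hn0] at h1
      have : 0 ≤ ∑ n ∈ Finset.range (N + 1), |s c n - n * r⁻¹| :=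
        Finset.sum_nonneg fun _ _ => abs_nonneg _
      linarith
  have hM0 : 0 ≤ M := by
    have := (abs_nonneg _).trans (hM 0)
    simpa using this
  refine ⟨(M + 1) * (r + ε) + 2, fun t ht => ?_⟩
  obtain ⟨h1, h2⟩ := h.flowCount_spec c ht
  set N := flowCount s c t with hN
  have a1 := (abs_le.1 (hM N)).1
  have a2 := (abs_le.1 (hM (N + 1))).2
  push_cast at a2
  set x : ℝ := (N : ℝ) with hx
  have hx0 : 0 ≤ x := Nat.cast_nonneg _
  have b1 : x * (r⁻¹ - δ) ≤ t + M := by nlinarith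
  have b2 : t ≤ (x + 1) * (r⁻¹ + δ) + M := by nlinarith
  have e1 : r⁻¹ - δ = (r + ε)⁻¹ := by rw [hδe]; field_simp; ring
  have e2 : r⁻¹ + δ ≤ 2 * r⁻¹ - (r + ε)⁻¹ := by linarith
  rw [e1, ← div_eq_mul_inv, div_le_iff₀ (by positivity)] at b1
  rw [abs_le]
  constructor
  · have e3 : (r⁻¹ + δ) * (r * (r + ε)) = r + 2 * ε := by rw [hδe]; field_simp; ring
    have b3 : t * (r * (r + ε)) ≤ (x + 1) * (r + 2 * ε) + M * (r * (r + ε)) := by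
      have := mul_le_mul_of_nonneg_right b2 (by positivity : 0 ≤ r * (r + ε))
      calc _ ≤ _ := this
        _ = (x + 1) * ((r⁻¹ + δ) * (r * (r + ε))) + M * (r * (r + ε)) := by ring
        _ = _ := by rw [e3]
    by_contra hcon
    push Not at hcon
    have hlt : (x + 1) * (r + 2 * ε) <
        (r * t - ε * t - (M + 1) * (r + ε) - 1) * (r + 2 * ε) := by
      refine mul_lt_mul_of_pos_right ?_ (by positivity)
      linarith
    have f1 : 0 ≤ t * (ε * ε) := by positivity
    have f2 : 0 ≤ M * ((r + ε) * ε) := by positivity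
    nlinarith [mul_pos hr hε, mul_pos hr hr, mul_pos hε hε]
  · nlinarith [mul_nonneg hM0 hr.le]

namespace Regular

variable {s : Source → ℕ → ℝ} (h : Regular s) (x₀ : ℤ × ℤ) {l1 l2 b : ℝ}
include h

lemma tendsto_fst (h1 : LinearGrowth (fun t => flowCount s .update1 t) l1) :
    Tendsto (fun t => ((stateAt s x₀ t).1 : ℝ) / t) atTop (𝓝 l1) := by
  have hc : Tendsto (fun t : ℝ => (x₀.1 : ℝ) / t) atTop (𝓝 0) :=
    tendsto_const_nhds.div_atTop tendsto_id
  have := hc.add h1.tendsto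
  rw [zero_add] at this
  refine this.congr' ?_
  filter_upwards [eventually_ge_atTop 0] with t ht
  rw [h.fst_stateAt x₀ ht]
  push_cast
  ring

/-- From below, the free walk has positive drift on `[u, t]`, so only counting errors can make the
lag negative. From above, no message falls in `(u, t]`, which forces `b (t - u)` to be of the order
of the counting errors; the number of updates of processor 2 in that interval is then of the same
order. -/
lemma linearGrowth_lag_of_lt (hl : l1 < l2) (hb : 0 < b) (hl1 : 0 < l1)
    (h1 : LinearGrowth (fun t => flowCount s .update1 t) l1)
    (h2 : LinearGrowth (fun t => flowCount s .update2 t) l2)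
    (h3 : LinearGrowth (fun t => flowCount s .message t) b) :
    LinearGrowth (fun t => lag (stateAt s x₀ t)) 0 := by
  intro ε hε
  -- The 4 covers the four counting errors in the lower bound; `2 * l2 / b` covers the drift `l2 (t
  -- - u)` since the last message.
  set C : ℝ := 4 + 2 * l2 / b with hC
  have hl2 : 0 < l2 := hl1.trans hl
  have hC0 : 0 < C := by positivity
  obtain ⟨K1, k1⟩ := h1 (ε / C) (by positivity)
  obtain ⟨K2, k2⟩ := h2 (ε / C) (by positivity)
  obtain ⟨K3, k3⟩ := h3 (ε / C) (by positivity)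
  set η := ε / C with hη
  have hη0 : 0 < η := by positivity
  have hηC : η * C = ε := by rw [hη]; field_simp
  set K := max K1 (max K2 K3) with hK
  refine ⟨C * K + |(lag x₀ : ℝ)|, fun t ht => ?_⟩
  -- The error must be uniform on `[0, t]`, since the time `u` supplied by the pathwise bounds is
  -- not controlled.
  have key : ∀ {f : ℝ → ℝ} {v K' : ℝ}, K' ≤ K → (∀ t ≥ 0, |f t - v * t| ≤ η * t + K') →
      ∀ u, 0 ≤ u → u ≤ t → |f u - v * u| ≤ η * t + K := by
    intro f v K' hK' hf u hu hut
    have := mul_le_mul_of_nonneg_left hut hη0.le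
    linarith [hf u hu]
  have g1 := key (le_max_left _ _) k1
  have g2 := key ((le_max_left _ _).trans (le_max_right _ _)) k2
  have g3 := key ((le_max_right _ _).trans (le_max_right _ _)) k3
  set B := η * t + K with hB
  have hB0 : 0 ≤ B := (abs_nonneg _).trans (g1 t ht le_rfl)
  have hCB : C * B = ε * t + C * K := by rw [hB, ← hηC]; ring
  have hgoal : ε * t + (C * K + |(lag x₀ : ℝ)|) = C * B + |(lag x₀ : ℝ)| := by rw [hCB]; ring
  rw [hgoal, zero_mul, sub_zero, abs_le]
  have t1 := abs_le.1 (g1 t ht le_rfl)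
  have t2 := abs_le.1 (g2 t ht le_rfl)
  have t3 := abs_le.1 (g3 t ht le_rfl)
  have hCB4 : 4 * B ≤ C * B := by
    refine mul_le_mul_of_nonneg_right ?_ hB0
    have : 0 ≤ 2 * l2 / b := by positivity
    linarith
  constructor
  · obtain ⟨u, hu0, hut, hle⟩ := h.exists_le_lag_stateAt x₀ ht
    have u1 := abs_le.1 (g1 u hu0 hut)
    have u2 := abs_le.1 (g2 u hu0 hut)
    have hle' : min (lag x₀ : ℝ) 0 + ((flowCount s .update2 t : ℝ) - flowCount s .update1 t) -
      ((flowCount s .update2 u : ℝ) - flowCount s .update1 u) ≤ lag (stateAt s x₀ t) := by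
      exact_mod_cast hle
    have hmin : -|(lag x₀ : ℝ)| ≤ min (lag x₀ : ℝ) 0 :=
      le_min (neg_abs_le _) (by simp)
    have hpos : 0 ≤ (l2 - l1) * (t - u) := mul_nonneg (by linarith) (by linarith)
    nlinarith
  · obtain ⟨u, hu0, hut, hle, hmsg⟩ := h.exists_lag_stateAt_le x₀ ht
    have u2 := abs_le.1 (g2 u hu0 hut)
    have u3 := abs_le.1 (g3 u hu0 hut)
    have hle' : (lag (stateAt s x₀ t) : ℝ) ≤ max (lag x₀ : ℝ) 0 + flowCount s .update2 t -
        flowCount s .update2 u := by exact_mod_cast hle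
    rw [hmsg] at t3
    have hmax : max (lag x₀ : ℝ) 0 ≤ |(lag x₀ : ℝ)| := max_le (le_abs_self _) (abs_nonneg _)
    have hbt : b * (t - u) ≤ 2 * B := by linarith [t3.1, u3.2]
    have hlt : l2 * (t - u) ≤ 2 * l2 / b * B := by
      have := mul_le_mul_of_nonneg_left hbt (by positivity : 0 ≤ l2 / b)
      calc l2 * (t - u) = l2 / b * (b * (t - u)) := by field_simp
        _ ≤ l2 / b * (2 * B) := this
        _ = _ := by ring
    have : C * B = 4 * B + 2 * l2 / b * B := by rw [hC]; ring
    linarith [t2.2, u2.1]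

lemma linearGrowth_lag_of_gt (hl : l2 < l1)
    (h1 : LinearGrowth (fun t => flowCount s .update1 t) l1)
    (h2 : LinearGrowth (fun t => flowCount s .update2 t) l2) :
    LinearGrowth (fun t => lag (stateAt s x₀ t)) (l2 - l1) := by
  -- With half the drift as tolerance for each flow, the linear terms cancel: the free walk is
  -- bounded above by `J1 + J2` at all times `u`.
  obtain ⟨J1, j1⟩ := h1 ((l1 - l2) / 2) (by linarith)
  obtain ⟨J2, j2⟩ := h2 ((l1 - l2) / 2) (by linarith)
  intro ε hε
  obtain ⟨K1, k1⟩ := h1 (ε / 2) (by positivity)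
  obtain ⟨K2, k2⟩ := h2 (ε / 2) (by positivity)
  refine ⟨K1 + K2 + |(lag x₀ : ℝ)| + |J1 + J2|, fun t ht => ?_⟩
  have t1 := abs_le.1 (k1 t ht)
  have t2 := abs_le.1 (k2 t ht)
  rw [abs_le]
  constructor
  · obtain ⟨u, hu0, hut, hle⟩ := h.exists_le_lag_stateAt x₀ ht
    have u1 := abs_le.1 (j1 u hu0)
    have u2 := abs_le.1 (j2 u hu0)
    have hle' : min (lag x₀ : ℝ) 0 + ((flowCount s .update2 t : ℝ) - flowCount s .update1 t) -
      ((flowCount s .update2 u : ℝ) - flowCount s .update1 u) ≤ lag (stateAt s x₀ t) := by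
      exact_mod_cast hle
    have hmin : -|(lag x₀ : ℝ)| ≤ min (lag x₀ : ℝ) 0 :=
      le_min (neg_abs_le _) (by simp)
    have := le_abs_self (J1 + J2)
    linarith [t1.2, t2.1, u1.1, u2.2]
  · have hle : (lag (stateAt s x₀ t) : ℝ) ≤ lag x₀ + flowCount s .update2 t -
        flowCount s .update1 t := by exact_mod_cast h.lag_stateAt_le x₀ ht
    have := le_abs_self (lag x₀ : ℝ)
    have := abs_nonneg (J1 + J2)
    linarith [t1.1, t2.2]

omit h in
lemma tendsto_snd {v w : ℝ}
    (h1 : Tendsto (fun t => ((stateAt s x₀ t).1 : ℝ) / t) atTop (𝓝 v))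
    (h2 : LinearGrowth (fun t => lag (stateAt s x₀ t)) w) :
    Tendsto (fun t => ((stateAt s x₀ t).2 : ℝ) / t) atTop (𝓝 (v + w)) := by
  refine (h1.add h2.tendsto).congr fun t => ?_
  rw [lag]; push_cast; ring

end Regular

lemma LinearGrowth.tendsto_atBot {f : ℝ → ℤ} {v : ℝ} (h : LinearGrowth (fun t => f t) v)
    (hv : v < 0) : Tendsto f atTop atBot := by
  rw [← tendsto_intCast_atBot_iff (R := ℝ)]
  obtain ⟨K, hK⟩ := h (-v / 2) (by linarith)
  have hlin : Tendsto (fun t : ℝ => v / 2 * t + K) atTop atBot :=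
    tendsto_atBot_add_const_right _ _ (tendsto_id.const_mul_atTop_of_neg (by linarith))
  refine tendsto_atBot_mono' _ ?_ hlin
  filter_upwards [eventually_ge_atTop 0] with t ht
  have := (abs_le.1 (hK t ht)).2
  linarith

/-! ### The flows seen from the first event -/

/-- The instants of the flows with gaps `G`. -/
def times (G : Source → ℕ → ℝ) : Source → ℕ → ℝ := fun c n => ∑ k ∈ Finset.range n, G c k

/-- The first event is an instant of the flow `c`. -/
def Wins (c : Source) (G : Source → ℕ → ℝ) : Prop := ∀ j, j ≠ c → G c 0 < G j 0

section
variable {G : Source → ℕ → ℝ} {c : Source}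

lemma times_one (G : Source → ℕ → ℝ) (c : Source) : times G c 1 = G c 0 := by
  simp [times]

lemma times_advance_self (n : ℕ) :
    times (advance c G) c n = times G c (n + 1) - G c 0 := by
  simp only [times, Finset.sum_range_succ', advance, if_true, gapTail, add_sub_cancel_right]

lemma times_advance_of_ne {c' : Source} (hc : c' ≠ c) (n : ℕ) :
    times (advance c G) c' (n + 1) = times G c' (n + 1) - G c 0 := by
  simp only [times, Finset.sum_range_succ', advance, hc, if_false, gapLower, gapTail, gapCons]
  ring

lemma exists_times_advance (c' : Source) (m : ℕ) :
    ∃ m', times (advance c G) c' (m + 1) = times G c' (m' + 1) - G c 0 := by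
  by_cases hc : c' = c
  · subst hc; exact ⟨m + 1, times_advance_self _⟩
  · exact ⟨m, times_advance_of_ne hc m⟩

lemma Regular.advance (h : Regular (times G)) (hw : Wins c G) :
    Regular (times (advance c G)) := by
  refine ⟨fun c' => by simp [times], fun c' => ?_, fun c' => ?_, fun c₁ c₂ hne m n => ?_⟩
  · refine strictMono_nat_of_lt_succ fun n => ?_
    by_cases hc : c' = c
    · subst hc
      rw [times_advance_self, times_advance_self]
      exact sub_lt_sub_right (h.mono c' (by omega)) _
    · cases n with
      | zero =>
        rw [times_advance_of_ne hc, zero_add, times_one]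
        simpa [times] using hw c' hc
      | succ n =>
        rw [times_advance_of_ne hc, times_advance_of_ne hc]
        exact sub_lt_sub_right (h.mono c' (by omega)) _
  · have hlim : Tendsto (fun n => times G c' (n + 1) - G c 0) atTop atTop :=
      tendsto_atTop_add_const_right _ _ ((tendsto_add_atTop_iff_nat 1).2 (h.lim c'))
    by_cases hc : c' = c
    · subst hc
      exact hlim.congr fun n => (times_advance_self n).symm
    · rw [← tendsto_add_atTop_iff_nat 1]
      exact hlim.congr fun n => (times_advance_of_ne hc n).symm
  · obtain ⟨m', hm⟩ := exists_times_advance (G := G) (c := c) c₁ m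
    obtain ⟨n', hn⟩ := exists_times_advance (G := G) (c := c) c₂ n
    rw [hm, hn]
    intro he
    exact h.ne c₁ c₂ hne m' n' (by linarith)

/-- Positivity of `t` excludes the winner's first instant, which is moved to time 0 and is no longer
counted. -/
lemma isInstant_advance {t : ℝ} (ht : 0 < t) (c' : Source) :
    IsInstant (times (advance c G)) c' t ↔ IsInstant (times G) c' (G c 0 + t) := by
  unfold IsInstant
  by_cases hc : c' = c
  · subst hc
    constructor
    · rintro ⟨n, hn⟩
      refine ⟨n + 1, ?_⟩
      rw [times_advance_self] at hn
      linarith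
    · rintro ⟨n, hn⟩
      cases n with
      | zero => rw [zero_add, times_one] at hn; linarith
      | succ n =>
        refine ⟨n, ?_⟩
        rw [times_advance_self]
        linarith
  · constructor
    · rintro ⟨n, hn⟩
      refine ⟨n, ?_⟩
      rw [times_advance_of_ne hc] at hn
      linarith
    · rintro ⟨n, hn⟩
      refine ⟨n, ?_⟩
      rw [times_advance_of_ne hc]
      linarith

lemma Regular.eventTime_one (h : Regular (times G)) (hw : Wins c G) :
    eventTime (times G) 1 = G c 0 := by
  refine eventTime_succ_eq ⟨⟨?_, c, 0, times_one G c⟩, ?_⟩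
  · have := h.mono c Nat.zero_lt_one
    rwa [h.zero, times_one] at this
  · rintro t ⟨-, c', n, rfl⟩
    have h1 : times G c' 1 ≤ times G c' (n + 1) := (h.mono c').monotone (by omega)
    rw [times_one] at h1
    by_cases hc : c' = c
    · rwa [hc] at h1 ⊢
    · exact (hw c' hc).le.trans h1

lemma Regular.eventTime_succ_advance (h : Regular (times G)) (hw : Wins c G) (n : ℕ) :
    eventTime (times G) (n + 1) = G c 0 + eventTime (times (TwoProc.advance c G)) n := by
  have h' := h.advance hw
  induction n with
  | zero => rw [zero_add, h.eventTime_one hw, eventTime, add_zero]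
  | succ n ih =>
    obtain ⟨⟨hlt, c', hc'⟩, hmin⟩ := h'.isLeast_eventTime n
    refine eventTime_succ_eq ⟨⟨by rw [ih]; linarith, c', ?_⟩, ?_⟩
    · rwa [← isInstant_advance ((h'.eventTime_nonneg n).trans_lt hlt)]
    · rintro t ⟨ht, c'', hc''⟩
      rw [ih] at ht
      have hpos : 0 < t - G c 0 := by linarith [h'.eventTime_nonneg n]
      have : t - G c 0 ∈ instantsAfter (times (TwoProc.advance c G))
          (eventTime (times (TwoProc.advance c G)) n) := by
        refine ⟨by linarith, c'', ?_⟩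
        rw [isInstant_advance hpos, add_sub_cancel]
        exact hc''
      linarith [hmin this]

/-- This is the pathwise half of the Markov property; `race` supplies the law of the advanced gaps.
-/
lemma Regular.stateAfter_succ_advance (h : Regular (times G)) (hw : Wins c G) (x : ℤ × ℤ) (n : ℕ) :
    stateAfter (times G) x (n + 1) =
      stateAfter (times (TwoProc.advance c G)) (act c x) n := by
  have h' := h.advance hw
  induction n with
  | zero =>
    have hc : IsInstant (times G) c (eventTime (times G) 1) :=
      ⟨0, by rw [h.eventTime_one hw, zero_add, times_one]⟩
    exact h.actAt_actAt_actAt hc x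
  | succ n ih =>
    obtain ⟨c', hc', -, hx⟩ := h'.exists_type n
    have hpos : 0 < eventTime (times (TwoProc.advance c G)) (n + 1) :=
      (h'.eventTime_nonneg n).trans_lt (h'.eventTime_strictMono (Nat.lt_succ_self n))
    rw [isInstant_advance hpos, ← h.eventTime_succ_advance hw] at hc'
    rw [stateAfter, h.actAt_actAt_actAt hc', ih, hx]

lemma Regular.exists_wins (h : Regular (times G)) : ∃ c, Wins c G := by
  obtain ⟨c, -, hc⟩ := Finset.exists_min_image Finset.univ (fun c => G c 0)
    ⟨Source.message, Finset.mem_univ _⟩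
  refine ⟨c, fun j hj => lt_of_le_of_ne (hc j (Finset.mem_univ j)) fun he => ?_⟩
  refine h.ne c j (Ne.symm hj) 0 0 ?_
  rw [zero_add, times_one, times_one, he]

lemma Wins.unique {c' : Source} (h : Wins c G) (h' : Wins c' G) : c = c' := by
  by_contra hne
  exact lt_asymm (h c' (Ne.symm hne)) (h' c hne)

end

/-! ### Measurable versions of the event times and of the states -/

lemma measurableSet_wins (c : Source) : MeasurableSet {G | Wins c G} := by
  unfold Wins
  rw [Set.ofPred_forall]
  refine MeasurableSet.iInter fun j => ?_
  rw [Set.ofPred_forall]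
  refine MeasurableSet.iInter fun _ => ?_
  exact measurableSet_lt ((measurable_pi_apply 0).comp (measurable_pi_apply c))
    ((measurable_pi_apply 0).comp (measurable_pi_apply j))

open Classical in
/-- The flow to which the first event belongs. -/
noncomputable def firstType (G : Source → ℕ → ℝ) : Source :=
  if Wins .update1 G then .update1 else if Wins .update2 G then .update2 else .message

lemma firstType_eq {c : Source} {G : Source → ℕ → ℝ} (h : Wins c G) : firstType G = c := by
  unfold firstType
  split_ifs with h1 h2
  · exact h1.unique h
  · exact h2.unique h
  · cases c
    · exact absurd h h1
    · exact absurd h h2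
    · rfl

/-- Functions defined by cases according to the first event are measurable. -/
lemma measurable_firstType {α : Type*} [MeasurableSpace α] {f : Source → (Source → ℕ → ℝ) → α}
    (hf : ∀ c, Measurable (f c)) : Measurable fun G => f (firstType G) G := by
  classical
  have : (fun G => f (firstType G) G) = fun G =>
      if Wins .update1 G then f .update1 G else
        if Wins .update2 G then f .update2 G else f .message G := by
    funext G
    unfold firstType
    split_ifs <;> rfl
  rw [this]
  exact (hf _).ite (measurableSet_wins _) ((hf _).ite (measurableSet_wins _) (hf _))

/-- The event times, as a function of the gaps. -/
noncomputable def chainTime : ℕ → (Source → ℕ → ℝ) → ℝ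
  | 0, _ => 0
  | n + 1, G => G (firstType G) 0 + chainTime n (advance (firstType G) G)

/-- The states after the events, as a function of the gaps. -/
noncomputable def chainState : ℕ → ℤ × ℤ → (Source → ℕ → ℝ) → ℤ × ℤ
  | 0, x, _ => x
  | n + 1, x, G => chainState n (act (firstType G) x) (advance (firstType G) G)

lemma measurable_chainTime (n : ℕ) : Measurable (chainTime n) := by
  induction n with
  | zero => exact measurable_const
  | succ n ih =>
    refine measurable_firstType (f := fun c G => G c 0 + chainTime n (advance c G)) fun c => ?_
    have h0 : Measurable fun G : Source → ℕ → ℝ => G c 0 :=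
      (measurable_pi_apply 0).comp (measurable_pi_apply c)
    exact h0.add (ih.comp (measurable_advance c))

lemma measurable_chainState (n : ℕ) (x : ℤ × ℤ) : Measurable (chainState n x) := by
  induction n generalizing x with
  | zero => exact measurable_const
  | succ n ih =>
    exact measurable_firstType (f := fun c G => chainState n (act c x) (advance c G)) fun c =>
      (ih (act c x)).comp (measurable_advance c)

/-- The recursion over the first event is visibly measurable, and this identity transfers that to
the infima defining the event times, up to null sets. -/
lemma Regular.chainTime_eq {G : Source → ℕ → ℝ} (h : Regular (times G)) (n : ℕ) :
    chainTime n G = eventTime (times G) n := by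
  induction n generalizing G with
  | zero => rfl
  | succ n ih =>
    obtain ⟨c, hc⟩ := h.exists_wins
    rw [chainTime, firstType_eq hc, ih (h.advance hc), h.eventTime_succ_advance hc]

lemma Regular.chainState_eq {G : Source → ℕ → ℝ} (h : Regular (times G)) (x : ℤ × ℤ) (n : ℕ) :
    chainState n x G = stateAfter (times G) x n := by
  induction n generalizing G x with
  | zero => rfl
  | succ n ih =>
    obtain ⟨c, hc⟩ := h.exists_wins
    rw [chainState, firstType_eq hc, ih (h.advance hc), h.stateAfter_succ_advance hc]

/-! ### The law of the gaps -/

/-- The joint law of the gaps of the three flows. -/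
noncomputable def gapsLaw (l1 l2 b : ℝ) : Measure (Source → ℕ → ℝ) :=
  Measure.pi fun c => gapLaw (rate l1 l2 b c)

/-- Two independent random variables are a.s. different if one of them has no atoms. -/
lemma measure_eq_of_indepFun {Ω : Type*} [MeasurableSpace Ω] {P : Measure Ω}
    [IsProbabilityMeasure P] {U V : Ω → ℝ} (hU : Measurable U) (hV : Measurable V)
    (hUV : IndepFun U V P) (h0 : ∀ a, P {ω | U ω = a} = 0) : P {ω | U ω = V ω} = 0 := by
  have hD : MeasurableSet {q : ℝ × ℝ | q.1 = q.2} :=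
    measurableSet_eq_fun measurable_fst measurable_snd
  have hpU := Measure.isProbabilityMeasure_map (μ := P) hU.aemeasurable
  have hpV := Measure.isProbabilityMeasure_map (μ := P) hV.aemeasurable
  have h1 : P {ω | U ω = V ω} = P.map (fun ω => (U ω, V ω)) {q : ℝ × ℝ | q.1 = q.2} := by
    rw [Measure.map_apply (hU.prodMk hV) hD]; rfl
  rw [h1, (indepFun_iff_map_prod_eq_prod_map_map hU.aemeasurable hV.aemeasurable).1 hUV,
    Measure.prod_apply_symm hD, lintegral_eq_zero_iff (measurable_measure_prodMk_right hD)]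
  refine Eventually.of_forall fun a => ?_
  have : (fun x : ℝ => (x, a)) ⁻¹' {q : ℝ × ℝ | q.1 = q.2} = {a} := by
    ext x; simp
  simp only [this]
  rw [Measure.map_apply hU (measurableSet_singleton a)]
  exact h0 a

section GapLaw
variable {r : ℝ} (hr : 0 < r)
include hr

lemma iIndepFun_gapLaw : iIndepFun (fun (n : ℕ) (x : ℕ → ℝ) => x n) (gapLaw r) := by
  have := isProbabilityMeasure_expMeasure hr
  exact iIndepFun_infinitePi (P := fun _ : ℕ => expMeasure r) (X := fun _ x => x)
    fun _ => measurable_id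

lemma map_eval_gapLaw (n : ℕ) : (gapLaw r).map (fun x => x n) = expMeasure r := by
  have := isProbabilityMeasure_expMeasure hr
  exact Measure.infinitePi_map_eval (fun _ : ℕ => expMeasure r) n

lemma ae_pos_gapLaw : ∀ᵐ x ∂gapLaw r, ∀ n, 0 < x n := by
  refine ae_all_iff.2 fun n => ?_
  refine ae_of_ae_map (f := fun x : ℕ → ℝ => x n) (measurable_pi_apply n).aemeasurable
    (p := fun y => 0 < y) ?_
  rw [map_eval_gapLaw hr]
  exact ae_pos_expMeasure r

/-- The last gap has no atoms and is independent of the sum of the previous ones. -/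
lemma gapLaw_partialSum_eq (n : ℕ) (a : ℝ) :
    gapLaw r {x | ∑ k ∈ Finset.range (n + 1), x k = a} = 0 := by
  have := isProbabilityMeasure_gapLaw hr
  have hind := (iIndepFun_gapLaw hr).indepFun_sum_range_succ (fun i => measurable_pi_apply i) n
  have hm : Measurable fun x : ℕ → ℝ => ∑ k ∈ Finset.range n, x k := by fun_prop
  have hind' : IndepFun (fun x : ℕ → ℝ => x n) (fun x => a - ∑ k ∈ Finset.range n, x k)
      (gapLaw r) := by
    have := hind.symm.comp (φ := id) (ψ := fun y : ℝ => a - y) measurable_id (by fun_prop)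
    convert this using 1 <;> (funext x; simp)
  have := measure_eq_of_indepFun (measurable_pi_apply n) (by fun_prop) hind' fun y => by
    have h1 := Measure.map_apply (μ := gapLaw r) (measurable_pi_apply (X := fun _ : ℕ => ℝ) n)
      (measurableSet_singleton y)
    have h2 := map_eval_gapLaw hr n
    have h3 : (gapLaw r).map (fun x => x n) {y} = 0 := by rw [h2]; simp
    rw [h1] at h3
    exact h3
  refine measure_mono_null (fun x hx => ?_) this
  simp only [Set.mem_ofPred_eq, Finset.sum_range_succ] at hx ⊢
  linarith

lemma strongLaw_gapLaw : ∀ᵐ x ∂gapLaw r,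
    Tendsto (fun n : ℕ => (∑ k ∈ Finset.range n, x k) / (n : ℝ)) atTop (𝓝 r⁻¹) := by
  have := isProbabilityMeasure_gapLaw hr
  have hint : Integrable (fun x : ℕ → ℝ => x 0) (gapLaw r) := by
    have h1 := integrable_id_expMeasure hr
    rw [← map_eval_gapLaw hr 0] at h1
    exact h1.comp_measurable (measurable_pi_apply 0)
  have hmean : ∫ x, x 0 ∂gapLaw r = r⁻¹ := by
    rw [← integral_id_expMeasure hr, ← map_eval_gapLaw hr 0,
      integral_map (measurable_pi_apply 0).aemeasurable (by fun_prop)]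
  rw [← hmean]
  refine strong_law_ae_real (fun (n : ℕ) (x : ℕ → ℝ) => x n) hint ?_ ?_
  · intro i j hij
    exact (iIndepFun_gapLaw hr).indepFun hij
  · intro i
    refine ⟨(measurable_pi_apply i).aemeasurable, (measurable_pi_apply 0).aemeasurable, ?_⟩
    rw [map_eval_gapLaw hr, map_eval_gapLaw hr]

end GapLaw

section GapsLaw
variable {l1 l2 b : ℝ} (hl1 : 0 < l1) (hl2 : 0 < l2) (hb : 0 < b)
include hl1 hl2 hb

lemma isProbabilityMeasure_gapsLaw : IsProbabilityMeasure (gapsLaw l1 l2 b) := by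
  have := fun c => isProbabilityMeasure_gapLaw (rate_pos hl1 hl2 hb c)
  unfold gapsLaw; infer_instance

lemma map_eval_gapsLaw (c : Source) :
    MeasurePreserving (fun G : Source → ℕ → ℝ => G c) (gapsLaw l1 l2 b)
      (gapLaw (rate l1 l2 b c)) := by
  have := fun c => isProbabilityMeasure_gapLaw (rate_pos hl1 hl2 hb c)
  exact measurePreserving_eval (fun c => gapLaw (rate l1 l2 b c)) c

lemma ae_strongLaw : ∀ᵐ G ∂gapsLaw l1 l2 b, ∀ c,
    Tendsto (fun n : ℕ => times G c n / n) atTop (𝓝 (rate l1 l2 b c)⁻¹) := by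
  refine ae_all_iff.2 fun c => ?_
  exact (map_eval_gapsLaw hl1 hl2 hb c).quasiMeasurePreserving.ae
    (strongLaw_gapLaw (rate_pos hl1 hl2 hb c))

/-- Positive gaps give monotonicity, the law of large numbers with positive mean gives divergence,
and independent atomless partial sums almost surely do not coincide. -/
lemma ae_regular : ∀ᵐ G ∂gapsLaw l1 l2 b, Regular (times G) := by
  have hP := fun c => isProbabilityMeasure_gapLaw (rate_pos hl1 hl2 hb c)
  have hP' := isProbabilityMeasure_gapsLaw hl1 hl2 hb
  have hpos : ∀ᵐ G ∂gapsLaw l1 l2 b, ∀ c n, 0 < G c n := by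
    refine ae_all_iff.2 fun c => ?_
    exact (map_eval_gapsLaw hl1 hl2 hb c).quasiMeasurePreserving.ae
      (ae_pos_gapLaw (rate_pos hl1 hl2 hb c))
  have hne : ∀ᵐ G ∂gapsLaw l1 l2 b, ∀ c c', c ≠ c' → ∀ m n,
      times G c (m + 1) ≠ times G c' (n + 1) := by
    refine ae_all_iff.2 fun c => ae_all_iff.2 fun c' => ae_all_iff.2 fun hcc =>
      ae_all_iff.2 fun m => ae_all_iff.2 fun n => ?_
    rw [ae_iff]
    simp only [not_not]
    have hmeas : ∀ m, Measurable fun x : ℕ → ℝ => ∑ k ∈ Finset.range (m + 1), x k := fun m => by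
      fun_prop
    have hind : iIndepFun (fun (c : Source) (G : Source → ℕ → ℝ) => G c) (gapsLaw l1 l2 b) :=
      iIndepFun_pi (X := fun _ x => x) fun _ => aemeasurable_id
    have hind' := (hind.indepFun hcc).comp (hmeas m) (hmeas n)
    refine measure_eq_of_indepFun ((hmeas m).comp (measurable_pi_apply c))
      ((hmeas n).comp (measurable_pi_apply c')) hind' fun a => ?_
    have hset : MeasurableSet {x : ℕ → ℝ | ∑ k ∈ Finset.range (m + 1), x k = a} :=
      hmeas m (measurableSet_singleton a)
    have := (map_eval_gapsLaw hl1 hl2 hb c).measure_preimage hset.nullMeasurableSet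
    rw [gapLaw_partialSum_eq (rate_pos hl1 hl2 hb c)] at this
    exact this
  filter_upwards [hpos, hne, ae_strongLaw hl1 hl2 hb] with G h1 h2 h3
  refine ⟨fun c => by simp [times], fun c => strictMono_nat_of_lt_succ fun n => ?_,
    fun c => ?_, h2⟩
  · simp only [times, Finset.sum_range_succ]
    linarith [h1 c n]
  · have hlim := Filter.Tendsto.pos_mul_atTop (inv_pos.2 (rate_pos hl1 hl2 hb c)) (h3 c)
      (tendsto_natCast_atTop_atTop (R := ℝ))
    refine hlim.congr' ?_
    filter_upwards [eventually_gt_atTop 0] with n hn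
    field_simp

/-- The lags along the events form a Markov chain. -/
lemma gapsLaw_lag_chainState (n : ℕ) (x : ℤ × ℤ) (y : ℕ → ℤ) :
    gapsLaw l1 l2 b {G | ∀ k ≤ n, lag (chainState k x G) = y k} =
      (if y 0 = lag x then 1 else 0) *
        ∏ k ∈ Finset.range n, transProb l1 l2 b (y k) (y (k + 1)) := by
  have hP := isProbabilityMeasure_gapsLaw hl1 hl2 hb
  induction n generalizing x y with
  | zero =>
    have : {G : Source → ℕ → ℝ | ∀ k ≤ 0, lag (chainState k x G) = y k} =
        {_G | y 0 = lag x} := by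
      ext G
      simp only [Nat.le_zero, forall_eq, Set.mem_ofPred_eq, chainState]
      exact eq_comm
    rw [this, Finset.range_zero, Finset.prod_empty, mul_one]
    split_ifs with h <;> simp [h]
  | succ n ih =>
    by_cases hy : y 0 = lag x
    · have hmeas : ∀ (x : ℤ × ℤ) (y : ℕ → ℤ), MeasurableSet {G : Source → ℕ → ℝ | ∀ k ≤ n,
          lag (chainState k x G) = y k} := by
        intro x y
        rw [Set.ofPred_forall]
        refine MeasurableSet.iInter fun k => ?_
        rw [Set.ofPred_forall]
        refine MeasurableSet.iInter fun _ => ?_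
        exact (measurable_chainState k x) (MeasurableSet.of_discrete (s := {z | lag z = y k}))
      -- The event is split according to the type of the first event; `race` and the induction
      -- hypothesis from `act c x` then evaluate each piece.
      set A : Source → Set (Source → ℕ → ℝ) := fun c => {G | Wins c G ∧
        advance c G ∈ {G | ∀ k ≤ n, lag (chainState k (act c x) G) = y (k + 1)}} with hA
      have hAm : ∀ c, MeasurableSet (A c) := fun c =>
        (measurableSet_wins c).inter (measurable_advance c (hmeas (act c x) fun k => y (k + 1)))
      have hAe : {G | ∀ k ≤ n + 1, lag (chainState k x G) = y k} =ᵐ[gapsLaw l1 l2 b]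
          ⋃ c, A c := by
        filter_upwards [ae_regular hl1 hl2 hb] with G hG
        obtain ⟨c, hc⟩ := hG.exists_wins
        apply propext
        change (∀ k ≤ n + 1, lag (chainState k x G) = y k) ↔ G ∈ ⋃ c, A c
        rw [Set.mem_iUnion]
        constructor
        · intro h
          refine ⟨c, hc, fun k hk => ?_⟩
          have := h (k + 1) (by omega)
          rwa [chainState, firstType_eq hc] at this
        · rintro ⟨c', hc', h⟩ k hk
          cases k with
          | zero => exact hy.symm
          | succ k =>
            rw [chainState, firstType_eq hc']
            exact h k (by omega)
      have hdisj : Pairwise (Function.onFun Disjoint A) := by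
        intro c c' hne
        refine Set.disjoint_left.2 fun G hG hG' => hne (hG.1.unique hG'.1)
      rw [measure_congr hAe, measure_iUnion hdisj hAm, tsum_fintype, if_pos hy, one_mul,
        Finset.prod_range_succ', transProb_eq_sum hl1 hl2 hb, Finset.mul_sum]
      refine Finset.sum_congr rfl fun c _ => ?_
      have hrace := race (rate l1 l2 b) (rate_pos hl1 hl2 hb) c
        (hmeas (act c x) fun k => y (k + 1))
      have hZ : rate l1 l2 b c / ∑ j, rate l1 l2 b j = typeProb l1 l2 b c := by
        rw [sum_source]; rfl
      rw [hZ] at hrace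
      refine hrace.trans ?_
      have hih := ih (act c x) fun k => y (k + 1)
      rw [gapsLaw] at hih
      rw [hih, lag_act, ← hy]
      simp only [zero_add]
      split_ifs
      · rw [one_mul, mul_comm]
      · simp
    · rw [if_neg hy, zero_mul]
      refine measure_mono_null (t := ∅) (fun G hG => ?_) measure_empty
      exact hy (hG 0 (Nat.zero_le _)).symm

end GapsLaw

/-! ### The process driven by random flows -/

section
variable {Ω : Type*} [MeasurableSpace Ω] {P : Measure Ω}

/-- The gaps of the flows. -/
def gaps (σ : Source → ℕ → Ω → ℝ) (ω : Ω) : Source → ℕ → ℝ :=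
  fun c n => σ c (n + 1) ω - σ c n ω

lemma measurable_gaps {σ : Source → ℕ → Ω → ℝ} (hσ : ∀ c n, Measurable (σ c n)) :
    Measurable (gaps σ) :=
  measurable_pi_lambda _ fun c => measurable_pi_lambda _ fun n => (hσ c (n + 1)).sub (hσ c n)

omit [MeasurableSpace Ω] in
lemma times_gaps {σ : Source → ℕ → Ω → ℝ} (h0 : ∀ c ω, σ c 0 ω = 0) (ω : Ω) :
    times (gaps σ ω) = fun c n => σ c n ω := by
  funext c n
  simp only [times, gaps]
  rw [Finset.sum_range_sub (fun k => σ c k ω), h0, sub_zero]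

/-- Almost sure convergence along the reals implies convergence in measure. -/
lemma tendstoInMeasure_atTop_of_ae [IsFiniteMeasure P] {f : ℝ → Ω → ℝ} {v : ℝ}
    (hf : ∀ t, AEMeasurable (f t) P) (h : ∀ᵐ ω ∂P, Tendsto (fun t => f t ω) atTop (𝓝 v)) :
    TendstoInMeasure P f atTop (fun _ => v) := by
  intro ε hε
  -- The filter `atTop` on the reals is countably generated, so it suffices to test along sequences
  -- of times.
  refine tendsto_of_seq_tendsto fun u hu => ?_
  refine tendstoInMeasure_of_tendsto_ae (f := fun n => f (u n))
    (fun n => (hf (u n)).aestronglyMeasurable) ?_ ε hε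
  filter_upwards [h] with ω hω using hω.comp hu

variable [IsProbabilityMeasure P] {l1 l2 b : ℝ} (hl1 : 0 < l1) (hl2 : 0 < l2) (hb : 0 < b)
  {σ : Source → ℕ → Ω → ℝ} (hflow : ∀ c, IsPoissonFlow P (σ c) (rate l1 l2 b c))
  (hindep : iIndepFun (fun (c : Source) (ω : Ω) (n : ℕ) => σ c n ω) P)

include hflow hindep in
-- This carries all statements about the law from the abstract probability space to the canonical
-- product space of gaps.
lemma map_gaps : P.map (gaps σ) = gapsLaw l1 l2 b := by
  have hm := measurable_gaps fun c => (hflow c).measurable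
  have hd : Measurable fun (x : ℕ → ℝ) (n : ℕ) => x (n + 1) - x n :=
    measurable_pi_lambda _ fun n => (measurable_pi_apply (n + 1)).sub (measurable_pi_apply n)
  have h1 : iIndepFun (fun (c : Source) (ω : Ω) => gaps σ ω c) P :=
    hindep.comp (fun _ x n => x (n + 1) - x n) fun _ => hd
  have h2 := (iIndepFun_iff_map_fun_eq_pi_map
    fun c => ((measurable_pi_apply c).comp hm).aemeasurable).1 h1
  have h3 : ∀ c, P.map (fun ω => gaps σ ω c) = gapLaw (rate l1 l2 b c) := by
    intro c
    have h4 := (hflow c).indep.map_fun_eq_infinitePi_map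
      fun n => ((hflow c).measurable (n + 1)).sub ((hflow c).measurable n)
    exact h4.trans (congrArg Measure.infinitePi (funext (hflow c).law))
  exact h2.trans (congrArg Measure.pi (funext h3))

include hl1 hl2 hb hflow hindep

lemma ae_regular_flow : ∀ᵐ ω ∂P, Regular fun c n => σ c n ω := by
  have hm := measurable_gaps fun c => (hflow c).measurable
  have h := ae_regular hl1 hl2 hb
  rw [← map_gaps hflow hindep] at h
  filter_upwards [ae_of_ae_map hm.aemeasurable h] with ω hω
  rwa [times_gaps fun c => (hflow c).zero] at hω

lemma ae_linearGrowth_flow : ∀ᵐ ω ∂P, ∀ c,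
    LinearGrowth (fun t => flowCount (fun c n => σ c n ω) c t) (rate l1 l2 b c) := by
  have hm := measurable_gaps fun c => (hflow c).measurable
  have h := ae_strongLaw hl1 hl2 hb
  rw [← map_gaps hflow hindep] at h
  filter_upwards [ae_of_ae_map hm.aemeasurable h, ae_regular_flow hl1 hl2 hb hflow hindep]
    with ω hω hreg c
  rw [times_gaps fun c => (hflow c).zero] at hω
  exact linearGrowth_flowCount hreg (rate_pos hl1 hl2 hb c) (hω c)

/-- Almost surely `X` is `chainState` evaluated at a measurable random index, the number of events
up to `t`. Measurability is needed to pass from almost sure convergence to convergence in measure.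
-/
lemma aemeasurable_X (x₀ : ℤ × ℤ) (t : ℝ) : AEMeasurable (X σ x₀ t) P := by
  have hm := measurable_gaps fun c => (hflow c).measurable
  have hN : Measurable fun G => Set.ncard {k : ℕ | 0 < k ∧ chainTime k G ≤ t} := by
    refine measurable_ncard.comp (measurable_set_iff.2 fun k => ?_)
    refine measurable_to_prop ?_
    by_cases hk : 0 < k
    · have : (fun G => k ∈ {k : ℕ | 0 < k ∧ chainTime k G ≤ t}) ⁻¹' {True} =
          {G | chainTime k G ≤ t} := by
        ext G; simp [hk]
      rw [this]
      exact measurableSet_le (measurable_chainTime k) measurable_const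
    · have : (fun G => k ∈ {k : ℕ | 0 < k ∧ chainTime k G ≤ t}) ⁻¹' {True} = ∅ := by
        ext G; simp [hk]
      rw [this]
      exact MeasurableSet.empty
  have hS : Measurable fun q : ℕ × (Source → ℕ → ℝ) => chainState q.1 x₀ q.2 :=
    measurable_from_prod_countable_right fun n => measurable_chainState n x₀
  refine ⟨fun ω => chainState (Set.ncard {k : ℕ | 0 < k ∧ chainTime k (gaps σ ω) ≤ t}) x₀
    (gaps σ ω), (hS.comp (hN.prodMk measurable_id)).comp hm, ?_⟩
  filter_upwards [ae_regular_flow hl1 hl2 hb hflow hindep] with ω hω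
  rw [← times_gaps fun c => (hflow c).zero] at hω
  simp only [hω.chainState_eq, hω.chainTime_eq, times_gaps fun c => (hflow c).zero]
  rfl

lemma isMarkovChain_Y (x₀ : ℤ × ℤ) :
    IsMarkovChain P (Y σ x₀) (transProb l1 l2 b) (x₀.2 - x₀.1) := by
  intro n y
  have hm := measurable_gaps fun c => (hflow c).measurable
  have hae : {ω | ∀ k ≤ n, Y σ x₀ k ω = y k} =ᵐ[P]
      gaps σ ⁻¹' {G | ∀ k ≤ n, lag (chainState k x₀ G) = y k} := by
    filter_upwards [ae_regular_flow hl1 hl2 hb hflow hindep] with ω hω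
    have hω' := hω
    rw [← times_gaps fun c => (hflow c).zero] at hω'
    apply propext
    change (∀ k ≤ n, Y σ x₀ k ω = y k) ↔ ∀ k ≤ n, lag (chainState k x₀ (gaps σ ω)) = y k
    have : ∀ k, Y σ x₀ k ω = lag (chainState k x₀ (gaps σ ω)) := by
      intro k
      rw [hω'.chainState_eq, times_gaps fun c => (hflow c).zero]
      simp only [Y, x1, x2, X, hω.stateAt_eventTime, lag]
    simp only [this]
  have hmeas : MeasurableSet {G : Source → ℕ → ℝ | ∀ k ≤ n, lag (chainState k x₀ G) = y k} := by
    rw [Set.ofPred_forall]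
    refine MeasurableSet.iInter fun k => ?_
    rw [Set.ofPred_forall]
    refine MeasurableSet.iInter fun _ => ?_
    exact (measurable_chainState k x₀) (MeasurableSet.of_discrete (s := {z | lag z = y k}))
  rw [measure_congr hae, ← Measure.map_apply hm hmeas, map_gaps hflow hindep,
    gapsLaw_lag_chainState hl1 hl2 hb]
  unfold lag
  congr

lemma hasSpeed_x1 (x₀ : ℤ × ℤ) : HasSpeed P (x1 σ x₀) l1 := by
  refine tendstoInMeasure_atTop_of_ae (fun t => ?_) ?_
  · have hz : Measurable fun z : ℤ × ℤ => (z.1 : ℝ) := Measurable.of_discrete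
    exact (hz.comp_aemeasurable (aemeasurable_X hl1 hl2 hb hflow hindep x₀ t)).div_const t
  · filter_upwards [ae_regular_flow hl1 hl2 hb hflow hindep,
      ae_linearGrowth_flow hl1 hl2 hb hflow hindep] with ω hω hg
    exact hω.tendsto_fst x₀ (hg .update1)

lemma hasSpeed_x2 (x₀ : ℤ × ℤ) {w : ℝ} (hw : ∀ᵐ ω ∂P,
    LinearGrowth (fun t => lag (X σ x₀ t ω)) w) : HasSpeed P (x2 σ x₀) (l1 + w) := by
  refine tendstoInMeasure_atTop_of_ae (fun t => ?_) ?_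
  · have hz : Measurable fun z : ℤ × ℤ => (z.2 : ℝ) := Measurable.of_discrete
    exact (hz.comp_aemeasurable (aemeasurable_X hl1 hl2 hb hflow hindep x₀ t)).div_const t
  · filter_upwards [ae_regular_flow hl1 hl2 hb hflow hindep,
      ae_linearGrowth_flow hl1 hl2 hb hflow hindep, hw] with ω hω hg hw
    exact Regular.tendsto_snd x₀ (hω.tendsto_fst x₀ (hg .update1)) hw

lemma ae_linearGrowth_lag_of_lt (x₀ : ℤ × ℤ) (hl : l1 < l2) :
    ∀ᵐ ω ∂P, LinearGrowth (fun t => lag (X σ x₀ t ω)) 0 := by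
  filter_upwards [ae_regular_flow hl1 hl2 hb hflow hindep,
    ae_linearGrowth_flow hl1 hl2 hb hflow hindep] with ω hω hg
  exact hω.linearGrowth_lag_of_lt x₀ hl hb hl1 (hg .update1) (hg .update2) (hg .message)

lemma ae_linearGrowth_lag_of_gt (x₀ : ℤ × ℤ) (hl : l2 < l1) :
    ∀ᵐ ω ∂P, LinearGrowth (fun t => lag (X σ x₀ t ω)) (l2 - l1) := by
  filter_upwards [ae_regular_flow hl1 hl2 hb hflow hindep,
    ae_linearGrowth_flow hl1 hl2 hb hflow hindep] with ω hω hg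
  exact hω.linearGrowth_lag_of_gt x₀ hl (hg .update1) (hg .update2)

end

end TwoProc

theorem theoremt {Ω : Type*} [MeasurableSpace Ω] (P : Measure Ω) [IsProbabilityMeasure P]
    (l1 l2 b : ℝ) (hl1 : 0 < l1) (hl2 : 0 < l2) (hb : 0 < b)
    (σ : TwoProc.Source → ℕ → Ω → ℝ)
    (hflow : ∀ c, TwoProc.IsPoissonFlow P (σ c) (TwoProc.rate l1 l2 b c))
    (hindep : iIndepFun (fun (c : TwoProc.Source) (ω : Ω) (n : ℕ) => σ c n ω) P)
    (x₀ : ℤ × ℤ) :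
    TwoProc.IsMarkovChain P (TwoProc.Y σ x₀) (TwoProc.transProb l1 l2 b) (x₀.2 - x₀.1) ∧
    (l1 < l2 →
      TwoProc.IsErgodic (TwoProc.transProb l1 l2 b) ∧
      TwoProc.HasSpeed P (TwoProc.x1 σ x₀) l1 ∧
      TwoProc.HasSpeed P (TwoProc.x2 σ x₀) l1) ∧
    (l2 < l1 →
      TwoProc.IsTransient (TwoProc.transProb l1 l2 b) ∧
      (∀ᵐ ω ∂P, Tendsto (fun t : ℝ => TwoProc.x2 σ x₀ t ω - TwoProc.x1 σ x₀ t ω) atTop atBot) ∧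
      TwoProc.HasSpeed P (TwoProc.x1 σ x₀) l1 ∧
      TwoProc.HasSpeed P (TwoProc.x2 σ x₀) l2) := by

  refine ⟨TwoProc.isMarkovChain_Y hl1 hl2 hb hflow hindep x₀, fun hl => ⟨?_, ?_, ?_⟩,
    fun hl => ⟨?_, ?_, ?_, ?_⟩⟩
  · exact TwoProc.isErgodic_transProb hl1 hl2 hb hl
  · exact TwoProc.hasSpeed_x1 hl1 hl2 hb hflow hindep x₀
  · simpa using TwoProc.hasSpeed_x2 hl1 hl2 hb hflow hindep x₀
      (TwoProc.ae_linearGrowth_lag_of_lt hl1 hl2 hb hflow hindep x₀ hl)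
  · exact TwoProc.isTransient_transProb hl1 hl2 hb hl
  · filter_upwards [TwoProc.ae_linearGrowth_lag_of_gt hl1 hl2 hb hflow hindep x₀ hl] with ω hω
    exact hω.tendsto_atBot (by linarith)
  · exact TwoProc.hasSpeed_x1 hl1 hl2 hb hflow hindep x₀
  · simpa using TwoProc.hasSpeed_x2 hl1 hl2 hb hflow hindep x₀
      (TwoProc.ae_linearGrowth_lag_of_gt hl1 hl2 hb hflow hindep x₀ hl)
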